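/- **Setting.** Let $\mathcal D'$ be the space of Schwartz distributions on $\mathbb R$ (complex-valued, derivatives are distributional), and let $\mathcal A\subset\mathcal D'$ consist of the piecewise smooth functions (smooth except on a finite set of points, where the function and all its derivatives have finite left and right limits) together with all their distributional derivatives. For $F,G\in\mathcal A$ put $F*G=\lim_{\epsilon\downarrow0}F(x)\cdot G(x+\epsilon)$, a limit in $\mathcal D'$, where $\cdot$ is the Hörmander product of distributions with disjoint singular supports (locally, the product of a distribution by a smooth function). The order $\operatorname{ord}F$ is the least $n\ge0$ such that $F$ is the $n$-th derivative of a locally integrable function. $H$ is the Heaviside function and $\delta_{\xi_0}$ the Dirac measure at $\xi_0$. Let $\xi_0\in\mathbb R$, $w\in\mathbb C$, and for $i=0,1$ let $$a_i=a_{i-}H(\xi_0-x)+a_{i+}H(x-\xi_0)+\sum_{j=0}^{1}A_{ij}\delta_{\xi_0}^{(j)},\qquad b_i=b_{i-}H(\xi_0-x)+b_{i+}H(x-\xi_0)+\sum_{j=0}^{3}B_{ij}\delta_{\xi_0}^{(j)},$$ with $a_{i\pm},b_{i\pm}\in\mathcal C^\infty(\mathbb R)$ complex-valued and $A_{ij},B_{ij}\in\mathbb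 C$. Put $a=a_{0-}+a_{1+}$ and $a_\pm=a_{0\pm}+a_{1\pm}$, and assume $a(\xi_0)\ne0$ and $a_+(x)\neq0$, $a_-(x)\ne0$ for all $x\in\mathbb R$. Consider the equation $$\sum_{i=0}^{2}\binom2i\left(a_0^{(i)}*\phi^{(4-i)}+\phi^{(4-i)}*a_1^{(i)}\right)-w^2\left(b_0*\phi+\phi*b_1\right)=0,\qquad\phi\in\mathcal A, \tag{E}$$ with boundary conditions $(\phi,\phi',\phi'',\phi''')(x_0)=C\in\mathbb C^4$ at a point $x_0\ne\xi_0$, meaning that $\phi$ coincides on an open interval containing $x_0$ with a function in $\mathcal C^\infty(\mathbb R)$ that has these derivatives at $x_0$. Let, with all functions evaluated at $\xi_0$, $$\mathbf A(\xi_0)=\begin{pmatrix}B_{10}w^2&-B_{11}w^2&a_-'+B_{12}w^2&a_--B_{13}w^2\\B_{11}w^2&-2B_{12}w^2&a_-+3B_{13}w^2&0\\-a'+B_{12}w^2&a-3B_{13}w^2&-A_{10}&A_{11}\\a+B_{13}w^2&0&-A_{11}&0\end{pmatrix},$$ $$\mathbf B(\xi_0)=\begin{pmatrix}-B_{00}w^2&B_{01}w^2&a_+'-B_{02}w^2&a_++B_{03}w^2\\-B_{01}w^2&2B_{02}w^2&a_+-3B_{03}w^2&0\\-a'-B_{02}w^2&a+3B_{03}w^2&A_{00}&-A_{01}\\a-B_{03}w^2&0&A_{01}&0\end{pmatrix}.$$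 **Corollary.** For $i=0$ (respectively $i=1$) suppose that one of the following holds: (a) $\operatorname{ord}a_i=0$ and $\operatorname{ord}b_i\le3$; (b) $\operatorname{ord}a_i\le1$ and $\operatorname{ord}b_i\le2$; (c) $\operatorname{ord}a_i\le2$ and $\operatorname{ord}b_i\le1$. Then for every $x_0<\xi_0$ (respectively $x_0>\xi_0$) and every $C\in\mathbb C^4$ the boundary value problem consisting of (E) and $(\phi,\phi',\phi'',\phi''')(x_0)=C$ has exactly one solution $\phi\in\mathcal A$. Moreover $\det\mathbf B(\xi_0)=a_+(\xi_0)^2a(\xi_0)^2\ne0$ (respectively $\det\mathbf A(\xi_0)=a_-(\xi_0)^2a(\xi_0)^2\neq0$). -/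

import Mathlib

open Set Filter Topology MeasureTheory TopologicalSpace
open scoped ContDiff Distributions

namespace EulerBernoulli

noncomputable section

/-- The space `𝒟` of complex-valued smooth compactly supported test functions on `ℝ`. -/
abbrev Test : Type := TestFunction (⊤ : Opens ℝ) ℂ ⊤

/-- The space `𝒟'` of Schwartz distributions on `ℝ`: continuous `ℂ`-linear forms on `𝒟`. -/
abbrev Distr : Type := Test →L[ℂ] ℂ

/-- The distributional derivative, `⟨F', t⟩ = -⟨F, t'⟩`. -/
def D (F : Distr) : Distr :=
  -(F ∘L (TestFunction.lineDerivCLM ℂ (1 : ℝ) : Test →L[ℂ] Test))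

/-- The regular distribution `t ↦ ∫ f t` of a locally integrable function `f`
(and `0` if `f` is not locally integrable). -/
def regular (f : ℝ → ℂ) : Distr :=
  TestFunction.integralAgainstBilinCLM (ContinuousLinearMap.mul ℂ ℂ) volume f

/-- The Dirac measure at `x`, `t ↦ t x`. -/
def dirac (x : ℝ) : Distr :=
  TestFunction.mkCLM ℂ (fun t : Test => t x) (fun _ _ => rfl) (fun _ _ => rfl) (fun _ hK =>
    (continuous_eval_const x : Continuous fun t : Test => t x).comp
      (TestFunction.continuous_ofSupportedIn hK))

/-- The translated test function `x ↦ t (x - ε)`. -/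
def translateTest (ε : ℝ) (t : Test) : Test where
  toFun x := t (x - ε)
  contDiff' := t.contDiff.comp (contDiff_id.sub contDiff_const)
  hasCompactSupport' := t.hasCompactSupport.comp_homeomorph (Homeomorph.subRight ε)
  tsupport_subset' := fun _ _ => trivial

/-- Translation of test functions is continuous. -/
def translateTestCLM (ε : ℝ) : Test →L[ℂ] Test :=
  TestFunction.limitCLM ℂ (translateTest ε)
    (fun K _ =>
      (TestFunction.ofSupportedInCLM ℂ (Ω := (⊤ : Opens ℝ))
        (K := ⟨(fun x => x + ε) '' (K : Set ℝ), K.isCompact.image (by fun_prop)⟩)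
        (fun _ _ => trivial)) ∘L
      ContDiffMapSupportedIn.mkCLM (𝕜 := ℂ) (fun t x => t (x - ε))
        (fun _ _ _ => rfl) (fun _ _ _ => rfl)
        (fun t => t.contDiff.comp (contDiff_id.sub contDiff_const))
        (fun t x hx => t.zero_on_compl (fun h => hx ⟨x - ε, h, by simp⟩))
        (fun i _ => ⟨{i}, 1, zero_le_one, fun t x _ => by
          rw [iteratedFDeriv_comp_sub]
          simpa using
            ContDiffMapSupportedIn.norm_iteratedFDeriv_apply_le_seminorm_top ℂ (f := t)⟩))
    (fun _ _ _ => rfl)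

/-- The translate `F(x + ε)` of a distribution: `⟨F(x + ε), t⟩ = ⟨F, t(x - ε)⟩`. -/
def shiftDistr (ε : ℝ) (F : Distr) : Distr := F ∘L translateTestCLM ε

/-- `f ∈ 𝒞_p^∞`: `f` is smooth except on a finite set of points, where `f` and all its derivatives
have finite left and right limits. -/
def IsPiecewiseSmooth (f : ℝ → ℂ) : Prop :=
  ∃ S : Set ℝ, S.Finite ∧ (∀ x ∉ S, ContDiffAt ℝ ∞ f x) ∧
    ∀ x ∈ S, ∀ k : ℕ,
      (∃ l : ℂ, Tendsto (iteratedDeriv k f) (𝓝[<] x) (𝓝 l)) ∧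
      (∃ r : ℂ, Tendsto (iteratedDeriv k f) (𝓝[>] x) (𝓝 r))

/-- The space `𝒜` of the piecewise smooth functions together with all their distributional
derivatives of all orders. -/
def spaceA : Set Distr :=
  {F | ∃ f : ℝ → ℂ, IsPiecewiseSmooth f ∧ ∃ n : ℕ, F = D^[n] (regular f)}

/-- The order of a distribution: the least `n` such that `F` is the `n`-th distributional
derivative of a regular distribution (`⊤` if there is none). -/
def ord (F : Distr) : ℕ∞ :=
  sInf {m | ∃ n : ℕ, m = n ∧ ∃ f : ℝ → ℂ, LocallyIntegrable f volume ∧ F = D^[n] (regular f)}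

/-- `F` and `G` have the same restriction to the open set `U`. -/
def EqOnOpen (U : Set ℝ) (F G : Distr) : Prop :=
  ∀ t : Test, tsupport t ⊆ U → F t = G t

/-- On the open set `U`, the distribution `F` is the smooth function `f ∈ 𝒞^∞(U)`. -/
def IsSmoothFunOn (U : Set ℝ) (F : Distr) (f : ℝ → ℂ) : Prop :=
  ContDiffOn ℝ ∞ f U ∧ ∀ t : Test, tsupport t ⊆ U → F t = ∫ x, f x * t x

/-- On the open set `U`, the distribution `P` is the dual product `F g` of `F` by
`g ∈ 𝒞^∞(U)`: `⟨P, t⟩ = ⟨F, g t⟩` for every test function `t` with support in `U`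
(`s` is the test function `g t`). -/
def IsDualProductOn (U : Set ℝ) (F : Distr) (g : ℝ → ℂ) (P : Distr) : Prop :=
  ∀ t s : Test, tsupport t ⊆ U → (∀ x, s x = g x * t x) → P t = F s

/-- `P` is the Hörmander product `F · G`: there is a finite open cover of `ℝ` on each member of
which one of `F`, `G` is a smooth function and `P` is the dual product of the other one by it. -/
def IsHormanderProduct (F G P : Distr) : Prop :=
  ∃ (d : ℕ) (U : Fin d → Set ℝ), (∀ i, IsOpen (U i)) ∧ (⋃ i, U i) = univ ∧
    ∀ i, (∃ g, IsSmoothFunOn (U i) G g ∧ IsDualProductOn (U i) F g P) ∨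
         (∃ f, IsSmoothFunOn (U i) F f ∧ IsDualProductOn (U i) G f P)

/-- `P = lim_{ε ↓ 0} F(x) · G(x + ε)`, where the Hörmander products need only be defined for
sufficiently small `ε > 0` and the limit is the distributional one. -/
def IsStarProduct (F G P : Distr) : Prop :=
  ∃ Q : ℝ → Distr,
    (∀ᶠ ε in 𝓝[>] (0 : ℝ), IsHormanderProduct F (shiftDistr ε G) (Q ε)) ∧
    ∀ t : Test, Tendsto (fun ε => Q ε t) (𝓝[>] 0) (𝓝 (P t))

open Classical in
/-- The multiplicative product `F * G` (with value `0` if the limit does not exist, which does not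
happen on `𝒜`). -/
def starProd (F G : Distr) : Distr :=
  if h : ∃ P, IsStarProduct F G P then h.choose else 0

/-- The distribution `f₋ H(ξ - x) + f₊ H(x - ξ) + ∑_{j < n} c_j δ_ξ^{(j)}`. -/
def coefficient {n : ℕ} (ξ : ℝ) (fm fp : ℝ → ℂ) (c : Fin n → ℂ) : Distr :=
  regular (fun x => (Iio ξ).indicator fm x + (Ioi ξ).indicator fp x) +
    ∑ j : Fin n, c j • D^[(j : ℕ)] (dirac ξ)

/-- `φ` is a solution, in `𝒜`, of
`∑_{i ≤ 2} (2 choose i) (a₀⁽ⁱ⁾ * φ⁽⁴⁻ⁱ⁾ + φ⁽⁴⁻ⁱ⁾ * a₁⁽ⁱ⁾) - w² (b₀ * φ + φ * b₁) = 0`. -/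
def IsSolution (a b : Fin 2 → Distr) (w : ℂ) (φ : Distr) : Prop :=
  φ ∈ spaceA ∧
    ∑ i ∈ Finset.range 3, (Nat.choose 2 i : ℂ) •
        (starProd (D^[i] (a 0)) (D^[4 - i] φ) + starProd (D^[4 - i] φ) (D^[i] (a 1)))
      - w ^ 2 • (starProd (b 0) φ + starProd φ (b 1)) = 0

/-- `φ` satisfies the boundary condition `(φ, φ', φ'', φ''')(x₀) = C`: on an open interval around
`x₀` it is a smooth function with these derivatives at `x₀`. -/
def SatisfiesBC (x₀ : ℝ) (C : Fin 4 → ℂ) (φ : Distr) : Prop :=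
  ∃ α β : ℝ, x₀ ∈ Ioo α β ∧ ∃ f : ℝ → ℂ, ContDiff ℝ ∞ f ∧
    EqOnOpen (Ioo α β) φ (regular f) ∧ ∀ k : Fin 4, iteratedDeriv k f x₀ = C k

/-- The alternative (a), (b), (c) for the coefficients `a_i = F`, `b_i = G`. -/
def OrderCondition (F G : Distr) : Prop :=
  (ord F = 0 ∧ ord G ≤ 3) ∨ (ord F ≤ 1 ∧ ord G ≤ 2) ∨ (ord F ≤ 2 ∧ ord G ≤ 1)

/-- `a = a₀₋ + a₁₊`. -/
def aMid (am ap : Fin 2 → ℝ → ℂ) (x : ℝ) : ℂ := am 0 x + ap 1 x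

/-- `a₊ = a₀₊ + a₁₊` (from `a_{i+}`), and likewise `a₋ = a₀₋ + a₁₋` (from `a_{i-}`). -/
def aSide (a : Fin 2 → ℝ → ℂ) (x : ℝ) : ℂ := a 0 x + a 1 x

/-- The matrix `𝐀(ξ)` of the interface condition `𝐀(ξ) φ̄₁(ξ) = 𝐁(ξ) φ̄₂(ξ)`. -/
def matA (ξ : ℝ) (w : ℂ) (am ap : Fin 2 → ℝ → ℂ) (A : Fin 2 → Fin 2 → ℂ)
    (B : Fin 2 → Fin 4 → ℂ) : Matrix (Fin 4) (Fin 4) ℂ :=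
  let a := aMid am ap ξ
  let a' := deriv (aMid am ap) ξ
  let m := aSide am ξ
  let m' := deriv (aSide am) ξ
  !![B 1 0 * w ^ 2, -B 1 1 * w ^ 2, m' + B 1 2 * w ^ 2, m - B 1 3 * w ^ 2;
     B 1 1 * w ^ 2, -2 * B 1 2 * w ^ 2, m + 3 * B 1 3 * w ^ 2, 0;
     -a' + B 1 2 * w ^ 2, a - 3 * B 1 3 * w ^ 2, -A 1 0, A 1 1;
     a + B 1 3 * w ^ 2, 0, -A 1 1, 0]

/-- The matrix `𝐁(ξ)` of the interface condition `𝐀(ξ) φ̄₁(ξ) = 𝐁(ξ) φ̄₂(ξ)`. -/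
def matB (ξ : ℝ) (w : ℂ) (am ap : Fin 2 → ℝ → ℂ) (A : Fin 2 → Fin 2 → ℂ)
    (B : Fin 2 → Fin 4 → ℂ) : Matrix (Fin 4) (Fin 4) ℂ :=
  let a := aMid am ap ξ
  let a' := deriv (aMid am ap) ξ
  let p := aSide ap ξ
  let p' := deriv (aSide ap) ξ
  !![-B 0 0 * w ^ 2, B 0 1 * w ^ 2, p' - B 0 2 * w ^ 2, p + B 0 3 * w ^ 2;
     -B 0 1 * w ^ 2, 2 * B 0 2 * w ^ 2, p - 3 * B 0 3 * w ^ 2, 0;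
     -a' - B 0 2 * w ^ 2, a + 3 * B 0 3 * w ^ 2, A 0 0, -A 0 1;
     a - B 0 3 * w ^ 2, 0, A 0 1, 0]

end

end EulerBernoulli

/-!
The distributions that occur are all of the form `f + ∑ₛ cₛ(D) δₛ`, with `f` piecewise smooth, `s`
ranging over a finite set and `cₛ` a polynomial in the derivative (`pw`, `exists_eq_pw`). This
representation is unique (`pw_eq_zero`), and it makes the product explicit: in `F * G` the functions
are multiplied, the point distributions of `F` are multiplied by the right germ of the function of
`G`, and those of `G` by the left germ of the function of `F` (`starProd_pw`). Only the one-sided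
jets of the functions enter; `mulJet h p` is the product of the point distribution `p` by a function
with jet `h`. As `D` acts on the functions by differentiation and adds `δₛ` times the jump (`D_pw`),
the Leibniz rule follows, and the equation becomes
`(a₀ * φ'' + φ'' * a₁)'' = w² (b₀ * φ + φ * b₁)`.

Comparing the representations of both sides yields an ordinary differential equation off the
singular points and an identity of polynomials at each of them (`equation_iff`). If `φ` had a point
distribution of degree `n` at `s`, the left side of this identity would have degree `n + 4`, its
leading coefficient being nonzero because `a(ξ₀)`, `a₋` and `a₊` are, while the right side has degree
at most `max n 3`; so `φ` is a function (`PointEquation.eq_zero`). The coefficients of `1`, `X`,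
`X²`, `X³` then say, away from `ξ₀`, that `φ` and its first three derivatives do not jump, and, at
`ξ₀`, that the jets of `φ` satisfy `𝐀 · (left jet) = 𝐁 · (right jet)` (`interface_equation_iff`).
Solutions are thus the pairs of global solutions of the two regular linear equations
`(a± u'')'' = w² b± u` that are matched by this condition at `ξ₀` (`isSolution_iff`). The data at
`x₀` determine one member of the pair, and an invertible matrix at `ξ₀` determines the other.

The order conditions force coefficients `A_{ij}`, `B_{ij}` to vanish: the `n`-th derivative of a
locally integrable function, tested against functions concentrating at a point, contains no
derivative of order `≥ n` of the Dirac measure (`coeff_eq_zero_of_eq_iterate_D`). The determinant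
then reduces to a product.
-/

namespace EulerBernoulli

open Polynomial

noncomputable section

/-! ### Test functions and distributions -/

/-- The derivative of a test function. -/
def testDeriv (t : Test) : Test := TestFunction.lineDerivCLM ℂ (1 : ℝ) t

theorem coe_testDeriv (t : Test) : ⇑(testDeriv t) = deriv t := by
  ext x
  have h : DifferentiableAt ℝ t x := (t.contDiff.differentiable (by simp)).differentiableAt
  rw [testDeriv, TestFunction.lineDerivCLM_apply_of_le (by simp), h.lineDeriv_eq_fderiv]
  simp

theorem D_apply (F : Distr) (t : Test) : D F t = -F (testDeriv t) := rfl

/-- The test function with underlying function `u`. -/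
def mkTest (u : ℝ → ℂ) (hu : ContDiff ℝ ∞ u) (hc : HasCompactSupport u) : Test where
  toFun := u
  contDiff' := hu
  hasCompactSupport' := hc
  tsupport_subset' := fun _ _ => trivial

@[simp] theorem coe_mkTest (u : ℝ → ℂ) (hu : ContDiff ℝ ∞ u) (hc : HasCompactSupport u) :
    ⇑(mkTest u hu hc) = u := rfl

/-- The distributional derivative as an endomorphism. -/
def DLin : Module.End ℂ Distr where
  toFun := D
  map_add' F G := by ext t; simp [D_apply]; ring
  map_smul' c F := by ext t; simp [D_apply]

@[simp] theorem DLin_apply (F : Distr) : DLin F = D F := rfl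

theorem D_add (F G : Distr) : D (F + G) = D F + D G := map_add DLin F G
theorem D_smul (c : ℂ) (F : Distr) : D (c • F) = c • D F := map_smul DLin c F
theorem D_sum {ι : Type*} (s : Finset ι) (F : ι → Distr) :
    D (∑ i ∈ s, F i) = ∑ i ∈ s, D (F i) := map_sum DLin F s

theorem iterate_D_apply (n : ℕ) (F : Distr) (t : Test) :
    D^[n] F t = (-1) ^ n * F (testDeriv^[n] t) := by
  induction n generalizing F with
  | zero => simp
  | succ n ih =>
    rw [Function.iterate_succ_apply, ih, D_apply, Function.iterate_succ_apply']
    ring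

theorem coe_iterate_testDeriv (n : ℕ) (t : Test) :
    ⇑(testDeriv^[n] t) = iteratedDeriv n t := by
  induction n with
  | zero => simp
  | succ n ih => rw [Function.iterate_succ_apply', coe_testDeriv, ih, iteratedDeriv_succ]

@[simp] theorem dirac_apply (x : ℝ) (t : Test) : dirac x t = t x := rfl

theorem regular_apply {f : ℝ → ℂ} (hf : LocallyIntegrable f) (t : Test) :
    regular f t = ∫ x, f x * t x := by
  rw [regular, TestFunction.integralAgainstBilinCLM_eq_integral]
  · simp [mul_comm]
  · exact hf.locallyIntegrableOn _

theorem integrable_mul_test {f : ℝ → ℂ} (hf : LocallyIntegrable f) (t : Test) :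
    Integrable fun x => f x * t x := by
  have := TestFunction.integrable_bilin (ContinuousLinearMap.mul ℂ ℂ)
    (hf.locallyIntegrableOn ((⊤ : Opens ℝ) : Set ℝ)) t
  simpa [mul_comm] using this

theorem regular_congr {f g : ℝ → ℂ} (hf : LocallyIntegrable f) (hg : LocallyIntegrable g)
    (h : f =ᵐ[volume] g) : regular f = regular g := by
  ext t
  rw [regular_apply hf, regular_apply hg]
  exact integral_congr_ae (h.mono fun x hx => by simp only [hx])

theorem regular_add {f g : ℝ → ℂ} (hf : LocallyIntegrable f) (hg : LocallyIntegrable g) :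
    regular (fun x => f x + g x) = regular f + regular g := by
  ext t
  rw [add_apply, regular_apply hf, regular_apply hg,
    regular_apply (hf.add hg : LocallyIntegrable (f + g)),
    ← integral_add (integrable_mul_test hf t) (integrable_mul_test hg t)]
  simp [add_mul]

theorem regular_const_mul {f : ℝ → ℂ} (hf : LocallyIntegrable f) (c : ℂ) :
    regular (fun x => c * f x) = c • regular f := by
  ext t
  rw [smul_apply, regular_apply hf,
    regular_apply (hf.smul c : LocallyIntegrable (c • f)), smul_eq_mul, ← integral_const_mul]
  simp [mul_assoc]

theorem regular_zero : regular (fun _ => 0) = 0 := by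
  ext t
  rw [regular_apply (locallyIntegrable_const 0)]
  simp

/-- A locally integrable function is determined almost everywhere by its regular distribution. -/
theorem ae_eq_zero_of_regular_eq_zero {f : ℝ → ℂ} (hf : LocallyIntegrable f)
    (h : regular f = 0) : ∀ᵐ x, f x = 0 := by
  refine ae_eq_zero_of_integral_contDiff_smul_eq_zero hf fun g hg hgc => ?_
  have hs : HasCompactSupport fun x => (g x : ℂ) := hgc.comp_left (g := ((↑) : ℝ → ℂ)) rfl
  have hsm : ContDiff ℝ ∞ fun x => (g x : ℂ) := Complex.ofRealCLM.contDiff.comp hg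
  have := congrArg (fun F : Distr => F (mkTest (fun x => (g x : ℂ)) hsm hs)) h
  simp only [regular_apply hf, coe_mkTest] at this
  simpa [mul_comm] using this

/-- Distributions that agree on the members of an open cover are equal. -/
theorem eq_of_eqOnOpen {ι : Type*} {U : ι → Set ℝ} (hU : ∀ i, IsOpen (U i))
    (hcov : ∀ x, ∃ i, x ∈ U i) {F G : Distr} (h : ∀ i, EqOnOpen (U i) F G) : F = G := by
  ext t
  obtain ⟨ρ, hρ⟩ := SmoothPartitionOfUnity.exists_isSubordinate (I := modelWithCornersSelf ℝ ℝ)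
    (s := tsupport t) (isClosed_tsupport t) U hU (fun x _ => mem_iUnion.2 (hcov x))
  -- local finiteness leaves finitely many members of the partition on the support of `t`
  have hfin : {i | (Function.support (ρ i) ∩ tsupport t).Nonempty}.Finite :=
    ρ.locallyFinite.finite_nonempty_inter_compact t.hasCompactSupport
  have hsm : ∀ i, ContDiff ℝ ∞ fun x => ((ρ i x : ℝ) : ℂ) * t x := fun i =>
    (Complex.ofRealCLM.contDiff.comp (ρ i).contMDiff.contDiff).mul t.contDiff
  have hcs : ∀ i, HasCompactSupport fun x => ((ρ i x : ℝ) : ℂ) * t x := fun i =>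
    t.hasCompactSupport.mul_left
  have ht : t = ∑ i ∈ hfin.toFinset, mkTest _ (hsm i) (hcs i) := by
    ext x
    have hsum : (∑ i ∈ hfin.toFinset, mkTest _ (hsm i) (hcs i)) x
        = ∑ i ∈ hfin.toFinset, ((ρ i x : ℝ) : ℂ) * t x := by
      have := map_sum (dirac x) (fun i => mkTest _ (hsm i) (hcs i)) hfin.toFinset
      simpa only [dirac_apply, coe_mkTest] using this
    rw [hsum, ← Finset.sum_mul]
    by_cases hx : x ∈ tsupport t
    · have h1 := ρ.sum_eq_one hx
      rw [finsum_eq_sum_of_support_subset (s := hfin.toFinset)] at h1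
      · rw [← Complex.ofReal_sum, h1]; simp
      · intro i hi
        simp only [Finite.coe_toFinset, mem_ofPred_eq]
        exact ⟨x, hi, hx⟩
    · simp [image_eq_zero_of_notMem_tsupport hx]
  rw [ht, map_sum, map_sum]
  refine Finset.sum_congr rfl fun i _ => h i _ ?_
  refine (closure_mono fun x hx => ?_).trans (hρ i)
  simp only [coe_mkTest, Function.mem_support, ne_eq, mul_eq_zero, not_or,
    Complex.ofReal_eq_zero] at hx
  exact hx.1

/-! ### Uniqueness of the products -/

theorem contDiff_mul_of_tsupport_subset {U : Set ℝ} (hU : IsOpen U) {f t : ℝ → ℂ}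
    (hf : ContDiffOn ℝ ∞ f U) (ht : ContDiff ℝ ∞ t) (hs : tsupport t ⊆ U) :
    ContDiff ℝ ∞ fun x => f x * t x := by
  refine contDiff_iff_contDiffAt.2 fun x => ?_
  by_cases hx : x ∈ tsupport t
  · exact (hf.contDiffAt (hU.mem_nhds (hs hx))).mul ht.contDiffAt
  · refine (contDiffAt_const (c := (0 : ℂ))).congr_of_eventuallyEq ?_
    filter_upwards [(isClosed_tsupport t).isOpen_compl.mem_nhds hx] with y hy
    rw [image_eq_zero_of_notMem_tsupport hy, mul_zero]

/-- The product of a test function by a function that is smooth near its support. -/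
def mulTest {U : Set ℝ} (hU : IsOpen U) {f : ℝ → ℂ} (hf : ContDiffOn ℝ ∞ f U) (t : Test)
    (hs : tsupport t ⊆ U) : Test :=
  mkTest (fun x => f x * t x) (contDiff_mul_of_tsupport_subset hU hf t.contDiff hs)
    t.hasCompactSupport.mul_left

@[simp] theorem coe_mulTest {U : Set ℝ} (hU : IsOpen U) {f : ℝ → ℂ} (hf : ContDiffOn ℝ ∞ f U)
    (t : Test) (hs : tsupport t ⊆ U) : ⇑(mulTest hU hf t hs) = fun x => f x * t x := rfl

theorem tsupport_mulTest_subset {U : Set ℝ} (hU : IsOpen U) {f : ℝ → ℂ}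
    (hf : ContDiffOn ℝ ∞ f U) (t : Test) (hs : tsupport t ⊆ U) :
    tsupport (mulTest hU hf t hs) ⊆ tsupport t := by
  rw [coe_mulTest]
  exact tsupport_mul_subset_right

theorem eqOn_of_isSmoothFunOn {U V : Set ℝ} (hU : IsOpen U) (hV : IsOpen V) {F : Distr}
    {f g : ℝ → ℂ} (hf : IsSmoothFunOn U F f) (hg : IsSmoothFunOn V F g) : EqOn f g (U ∩ V) := by
  have hUV := hU.inter hV
  have hfc : ContDiffOn ℝ ∞ f (U ∩ V) := hf.1.mono inter_subset_left
  have hgc : ContDiffOn ℝ ∞ g (U ∩ V) := hg.1.mono inter_subset_right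
  have hloc : LocallyIntegrableOn (f - g) (U ∩ V) :=
    (hfc.continuousOn.sub hgc.continuousOn).locallyIntegrableOn hUV.measurableSet
  have hae := hUV.ae_eq_zero_of_integral_contDiff_smul_eq_zero hloc (fun w hw hwc hws => by
    have hs : HasCompactSupport fun x => (w x : ℂ) := hwc.comp_left (g := ((↑) : ℝ → ℂ)) rfl
    have hsm : ContDiff ℝ ∞ fun x => (w x : ℂ) := Complex.ofRealCLM.contDiff.comp hw
    set t : Test := mkTest (fun x => (w x : ℂ)) hsm hs with ht
    have hts : tsupport t = tsupport w := by
      simp only [tsupport, ht, coe_mkTest]; congr 1; ext x; simp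
    have h1 := hf.2 t (by rw [hts]; exact hws.trans inter_subset_left)
    have h2 := hg.2 t (by rw [hts]; exact hws.trans inter_subset_right)
    have hint : ∀ k : ℝ → ℂ, ContDiffOn ℝ ∞ k (U ∩ V) → Integrable fun x => k x * t x :=
      fun k hk => (contDiff_mul_of_tsupport_subset hUV hk t.contDiff
        (hts ▸ hws)).continuous.integrable_of_hasCompactSupport t.hasCompactSupport.mul_left
    have : ∀ x, w x • (f - g) x = f x * t x - g x * t x := fun x => by
      simp only [ht, coe_mkTest, Pi.sub_apply, Complex.real_smul]; ring
    simp_rw [this]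
    rw [integral_sub (hint f hfc) (hint g hgc), ← h1, ← h2, sub_self])
  have hae' : f =ᵐ[volume.restrict (U ∩ V)] g := by
    rw [Filter.EventuallyEq, ae_restrict_iff' hUV.measurableSet]
    exact hae.mono fun x hx hm => sub_eq_zero.1 (hx hm)
  exact Measure.eqOn_open_of_ae_eq hae' hUV hfc.continuousOn hgc.continuousOn

/-- The two ways to form a Hörmander product locally are compatible. -/
theorem eqOnOpen_of_isDualProductOn {U V : Set ℝ} (hU : IsOpen U) (hV : IsOpen V)
    {F G P P' : Distr} {f g : ℝ → ℂ} (hg : IsSmoothFunOn U G g) (hP : IsDualProductOn U F g P)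
    (hf : IsSmoothFunOn V F f) (hP' : IsDualProductOn V G f P') : EqOnOpen (U ∩ V) P P' := by
  intro t ht
  have htU : tsupport t ⊆ U := ht.trans inter_subset_left
  have htV : tsupport t ⊆ V := ht.trans inter_subset_right
  rw [hP t (mulTest hU hg.1 t htU) htU fun _ => rfl,
    hP' t (mulTest hV hf.1 t htV) htV fun _ => rfl,
    hf.2 _ ((tsupport_mulTest_subset ..).trans htV),
    hg.2 _ ((tsupport_mulTest_subset ..).trans htU)]
  simp only [coe_mulTest]
  exact integral_congr_ae (ae_of_all _ fun x => by ring_nf)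

theorem eqOnOpen_of_isDualProductOn_of_isDualProductOn {U V : Set ℝ} (hU : IsOpen U)
    (hV : IsOpen V) {F G P P' : Distr} {g g' : ℝ → ℂ} (hg : IsSmoothFunOn U G g)
    (hP : IsDualProductOn U F g P) (hg' : IsSmoothFunOn V G g')
    (hP' : IsDualProductOn V F g' P') : EqOnOpen (U ∩ V) P P' := by
  intro t ht
  have htU : tsupport t ⊆ U := ht.trans inter_subset_left
  rw [hP t (mulTest hU hg.1 t htU) htU fun _ => rfl]
  refine (hP' t _ (ht.trans inter_subset_right) fun x => ?_).symm
  by_cases hx : x ∈ tsupport t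
  · simp [eqOn_of_isSmoothFunOn hU hV hg hg' (ht hx)]
  · simp [image_eq_zero_of_notMem_tsupport hx]

theorem IsHormanderProduct.unique {F G P P' : Distr} (h : IsHormanderProduct F G P)
    (h' : IsHormanderProduct F G P') : P = P' := by
  obtain ⟨d, U, hU, hUc, hP⟩ := h
  obtain ⟨e, V, hV, hVc, hP'⟩ := h'
  refine eq_of_eqOnOpen (U := fun p : Fin d × Fin e => U p.1 ∩ V p.2)
    (fun p => (hU _).inter (hV _)) (fun x => ?_) fun p => ?_
  · obtain ⟨i, hi⟩ := mem_iUnion.1 (hUc.ge (mem_univ x))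
    obtain ⟨j, hj⟩ := mem_iUnion.1 (hVc.ge (mem_univ x))
    exact ⟨(i, j), hi, hj⟩
  · rcases hP p.1 with ⟨g, hg, hgP⟩ | ⟨f, hf, hfP⟩ <;>
      rcases hP' p.2 with ⟨g', hg', hgP'⟩ | ⟨f', hf', hfP'⟩
    · exact eqOnOpen_of_isDualProductOn_of_isDualProductOn (hU _) (hV _) hg hgP hg' hgP'
    · exact eqOnOpen_of_isDualProductOn (hU _) (hV _) hg hgP hf' hfP'
    · exact eqOnOpen_of_isDualProductOn (hU _) (hV _) hf hfP hg' hgP'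
    · exact eqOnOpen_of_isDualProductOn_of_isDualProductOn (hU _) (hV _) hf hfP hf' hfP'

theorem IsStarProduct.unique {F G P P' : Distr} (h : IsStarProduct F G P)
    (h' : IsStarProduct F G P') : P = P' := by
  obtain ⟨Q, hQ, hl⟩ := h
  obtain ⟨Q', hQ', hl'⟩ := h'
  ext t
  refine tendsto_nhds_unique_of_eventuallyEq (hl t) (hl' t) ?_
  filter_upwards [hQ, hQ'] with ε h1 h2
  rw [h1.unique h2]

theorem IsStarProduct.starProd_eq {F G P : Distr} (h : IsStarProduct F G P) :
    starProd F G = P := by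
  have hex : ∃ P, IsStarProduct F G P := ⟨P, h⟩
  rw [starProd, dif_pos hex]
  exact hex.choose_spec.unique h

/-! ### Distributions supported at a point -/

/-- The distribution `∑ⱼ pⱼ δ_s^{(j)}` encoded by the polynomial `p`. -/
def deltaPoly (s : ℝ) : ℂ[X] →ₗ[ℂ] Distr where
  toFun p := aeval DLin p (dirac s)
  map_add' p q := by simp
  map_smul' c p := by simp

theorem deltaPoly_C (s : ℝ) (z : ℂ) : deltaPoly s (C z) = z • dirac s := by
  simp [deltaPoly, Algebra.algebraMap_eq_smul_one]

theorem deltaPoly_X_mul (s : ℝ) (p : ℂ[X]) : deltaPoly s (X * p) = D (deltaPoly s p) := by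
  simp [deltaPoly]

theorem deltaPoly_X_pow (s : ℝ) (n : ℕ) : deltaPoly s (X ^ n) = D^[n] (dirac s) := by
  induction n with
  | zero => simpa using deltaPoly_C s 1
  | succ n ih => rw [pow_succ', deltaPoly_X_mul, ih, Function.iterate_succ_apply']

/-- Induction over polynomials by constants, multiplication by `X` and addition. -/
theorem polynomial_induction {P : ℂ[X] → Prop} (hC : ∀ z, P (C z)) (hX : ∀ p, P p → P (X * p))
    (hadd : ∀ p q, P p → P q → P (p + q)) (p : ℂ[X]) : P p := by
  induction p using Polynomial.induction_on' with
  | add p q hp hq => exact hadd p q hp hq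
  | monomial n a =>
    induction n with
    | zero => exact hC a
    | succ n ih => rw [← X_mul_monomial]; exact hX _ ih

/-- The value at a function `u`, smooth near `s`, of the distribution encoded by a polynomial:
`∑ⱼ (-1)ʲ pⱼ u^{(j)}(s)`. -/
def evalJet (s : ℝ) (u : ℝ → ℂ) : ℂ[X] →ₗ[ℂ] ℂ :=
  Polynomial.lsum fun j => LinearMap.toSpanSingleton ℂ ℂ ((-1) ^ j * iteratedDeriv j u s)

theorem evalJet_monomial (s : ℝ) (u : ℝ → ℂ) (j : ℕ) (z : ℂ) :
    evalJet s u (monomial j z) = z * ((-1) ^ j * iteratedDeriv j u s) := by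
  simp [evalJet, Polynomial.lsum_apply, sum_monomial_index]

theorem evalJet_C (s : ℝ) (u : ℝ → ℂ) (z : ℂ) : evalJet s u (C z) = z * u s := by
  simpa using evalJet_monomial s u 0 z

theorem evalJet_X_mul (s : ℝ) (u : ℝ → ℂ) (p : ℂ[X]) :
    evalJet s u (X * p) = -evalJet s (deriv u) p := by
  induction p using Polynomial.induction_on' with
  | add p q hp hq => rw [mul_add, map_add, map_add, hp, hq]; ring
  | monomial n a =>
    rw [X_mul_monomial, evalJet_monomial, evalJet_monomial, iteratedDeriv_succ']
    ring

theorem evalJet_congr {s : ℝ} {u v : ℝ → ℂ} (h : u =ᶠ[𝓝 s] v) : evalJet s u = evalJet s v := by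
  simp only [evalJet, h.iteratedDeriv_eq]

theorem contDiffAt_deriv {u : ℝ → ℂ} {s : ℝ} (h : ContDiffAt ℝ ∞ u s) :
    ContDiffAt ℝ ∞ (deriv u) s := by
  have h1 : ContDiffAt ℝ ∞ (fderiv ℝ u) s := h.fderiv_right (by simp)
  exact h1.clm_apply contDiffAt_const

theorem evalJet_add {s : ℝ} {u v : ℝ → ℂ} (hu : ContDiffAt ℝ ∞ u s) (hv : ContDiffAt ℝ ∞ v s)
    (p : ℂ[X]) : evalJet s (fun x => u x + v x) p = evalJet s u p + evalJet s v p := by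
  induction p using Polynomial.induction_on' with
  | add p q hp hq => rw [map_add, map_add, map_add, hp, hq]; ring
  | monomial n a =>
    simp only [evalJet_monomial]
    rw [iteratedDeriv_fun_add (hu.of_le (by exact_mod_cast le_top))
      (hv.of_le (by exact_mod_cast le_top))]
    ring

theorem deltaPoly_apply (s : ℝ) (p : ℂ[X]) (t : Test) : deltaPoly s p t = evalJet s t p := by
  induction p using polynomial_induction generalizing t with
  | hC z => simp [deltaPoly_C, evalJet_C]
  | hX p ih => rw [deltaPoly_X_mul, D_apply, ih, evalJet_X_mul, coe_testDeriv]
  | hadd p q hp hq => rw [map_add, map_add, add_apply, hp, hq]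

/-- The polynomial of the product of `δ_s^{(n)}` by a function with jet `h` at `s`, computed from
`g δ_s^{(n+1)} = (g δ_s^{(n)})' - g' δ_s^{(n)}`. -/
def mulJetPow : (ℕ → ℂ) → ℕ → ℂ[X]
  | h, 0 => C (h 0)
  | h, n + 1 => X * mulJetPow h n - mulJetPow (fun k => h (k + 1)) n

/-- The polynomial of the product, by a function with jet `h` at `s`, of the distribution at `s`
with polynomial `p`. -/
def mulJet (h : ℕ → ℂ) : ℂ[X] →ₗ[ℂ] ℂ[X] :=
  Polynomial.lsum fun n => LinearMap.toSpanSingleton ℂ _ (mulJetPow h n)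

theorem mulJet_monomial (h : ℕ → ℂ) (n : ℕ) (z : ℂ) :
    mulJet h (monomial n z) = C z * mulJetPow h n := by
  simp [mulJet, Polynomial.lsum_apply, sum_monomial_index, smul_eq_C_mul]

theorem mulJet_C (h : ℕ → ℂ) (z : ℂ) : mulJet h (C z) = C (z * h 0) := by
  simpa [mulJetPow] using mulJet_monomial h 0 z

/-- The Leibniz rule for the product of a jet by a distribution at a point. -/
theorem mulJet_X_mul (h : ℕ → ℂ) (p : ℂ[X]) :
    mulJet h (X * p) = X * mulJet h p - mulJet (fun k => h (k + 1)) p := by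
  induction p using Polynomial.induction_on' with
  | add p q hp hq => simp only [mul_add, map_add, hp, hq]; ring
  | monomial n a =>
    rw [X_mul_monomial, mulJet_monomial, mulJet_monomial, mulJet_monomial, mulJetPow]
    ring

theorem mulJet_add_jet (h k : ℕ → ℂ) (p : ℂ[X]) :
    mulJet (fun n => h n + k n) p = mulJet h p + mulJet k p := by
  induction p using polynomial_induction generalizing h k with
  | hC z => simp only [mulJet_C, mul_add, map_add]
  | hX p ih => simp only [mulJet_X_mul, ih]; ring
  | hadd p q hp hq => simp only [map_add, hp, hq]; ring

theorem mulJetPow_degree (h : ℕ → ℂ) (n : ℕ) :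
    (mulJetPow h n).natDegree ≤ n ∧ (mulJetPow h n).coeff n = h 0 := by
  induction n generalizing h with
  | zero => simp [mulJetPow]
  | succ n ih =>
    have h2 := ih fun k => h (k + 1)
    refine ⟨(natDegree_sub_le _ _).trans (max_le ?_ (h2.1.trans n.le_succ)), ?_⟩
    · exact natDegree_mul_le.trans (by
      rw [natDegree_X, add_comm]; exact Nat.succ_le_succ (ih h).1)
    · rw [mulJetPow, coeff_sub, coeff_X_mul, (ih h).2,
        coeff_eq_zero_of_natDegree_lt (Nat.lt_succ_of_le h2.1), sub_zero]

/-- Multiplication by a function does not raise the order, and multiplies the leading coefficient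
by the value of the function. -/
theorem mulJet_degree (h : ℕ → ℂ) (n : ℕ) (p : ℂ[X]) (hp : p.natDegree ≤ n) :
    (mulJet h p).natDegree ≤ n ∧ (mulJet h p).coeff n = h 0 * p.coeff n := by
  refine Polynomial.induction_with_natDegree_le (motive := fun p => (mulJet h p).natDegree ≤ n ∧
    (mulJet h p).coeff n = h 0 * p.coeff n) n ?_ ?_ ?_ p hp
  · simp
  · intro m a _ hm
    have h1 := mulJetPow_degree h m
    rw [C_mul_X_pow_eq_monomial, mulJet_monomial, coeff_C_mul, coeff_monomial]
    refine ⟨(natDegree_C_mul_le _ _).trans (h1.1.trans hm), ?_⟩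
    split_ifs with hmn
    · rw [← hmn, h1.2, mul_comm]
    · rw [coeff_eq_zero_of_natDegree_lt (lt_of_le_of_lt h1.1 (lt_of_le_of_ne hm hmn))]; simp
  · intro f g _ _ h1 h2
    rw [map_add, coeff_add, coeff_add, h1.2, h2.2, mul_add]
    exact ⟨(natDegree_add_le _ _).trans (max_le h1.1 h2.1), rfl⟩

/-- `mulJet` is the transpose of the multiplication of functions by `g`. -/
theorem evalJet_mulJet {s : ℝ} {g u : ℝ → ℂ} (hg : ContDiffAt ℝ ∞ g s) (hu : ContDiffAt ℝ ∞ u s)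
    (p : ℂ[X]) :
    evalJet s u (mulJet (fun k => iteratedDeriv k g s) p) = evalJet s (fun x => g x * u x) p := by
  induction p using polynomial_induction generalizing g u with
  | hC z => simp only [mulJet_C, evalJet_C, iteratedDeriv_zero]; ring
  | hX p ih =>
    have hd : deriv (fun x => g x * u x) =ᶠ[𝓝 s]
        fun x => deriv g x * u x + g x * deriv u x := by
      have h1 := (hg.of_le (m := 1) (by simp)).eventually (by simp)
      have h2 := (hu.of_le (m := 1) (by simp)).eventually (by simp)
      filter_upwards [h1, h2] with x h1 h2
      exact deriv_fun_mul (h1.differentiableAt (by simp)) (h2.differentiableAt (by simp))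
    rw [mulJet_X_mul, map_sub, evalJet_X_mul, evalJet_X_mul, ih hg (contDiffAt_deriv hu),
      evalJet_congr hd, evalJet_add ((contDiffAt_deriv hg).mul hu) (hg.mul (contDiffAt_deriv hu)),
      ← ih (contDiffAt_deriv hg) hu]
    simp only [iteratedDeriv_succ']
    ring
  | hadd p q hp hq => simp only [map_add, hp hg hu, hq hg hu]

/-- Continuity of the pairing with a distribution at a point, in the point and the jet. -/
theorem tendsto_deltaPoly_mulJet {l : Filter ℝ} {x : ℝ → ℝ} {s : ℝ} (hx : Tendsto x l (𝓝 s))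
    (p : ℂ[X]) {h : ℝ → ℕ → ℂ} {h₀ : ℕ → ℂ} (hh : ∀ k, Tendsto (fun ε => h ε k) l (𝓝 (h₀ k)))
    (t : Test) :
    Tendsto (fun ε => deltaPoly (x ε) (mulJet (h ε) p) t) l (𝓝 (deltaPoly s (mulJet h₀ p) t)) := by
  induction p using polynomial_induction generalizing h h₀ t with
  | hC z =>
    simp only [mulJet_C, deltaPoly_C, smul_apply, dirac_apply, smul_eq_mul]
    exact ((hh 0).const_mul z).mul ((t.continuous.tendsto s).comp hx)
  | hX p ih =>
    simp only [mulJet_X_mul, map_sub, sub_apply, deltaPoly_X_mul, D_apply]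
    exact (ih hh (testDeriv t)).neg.sub (ih (fun k => hh (k + 1)) t)
  | hadd p q hp hq =>
    simp only [map_add, add_apply]
    exact (hp hh t).add (hq hh t)

theorem deltaPoly_apply_eq_zero {s : ℝ} {t : Test} (hs : s ∉ tsupport t) (p : ℂ[X]) :
    deltaPoly s p t = 0 := by
  have h : (t : ℝ → ℂ) =ᶠ[𝓝 s] fun _ => 0 := notMem_tsupport_iff_eventuallyEq.1 hs
  rw [deltaPoly_apply, evalJet_congr h]
  induction p using polynomial_induction with
  | hC z => simp [evalJet_C]
  | hX p ih => simpa [evalJet_X_mul] using ih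
  | hadd p q hp hq => simp [hp, hq]

/-! ### Piecewise smooth functions and their one-sided jets -/

/-- `l` is the filter of left, or of right, neighbourhoods of `x`. -/
def IsSide (l : Filter ℝ) (x : ℝ) : Prop := l = 𝓝[<] x ∨ l = 𝓝[>] x

theorem isSide_left (x : ℝ) : IsSide (𝓝[<] x) x := Or.inl rfl
theorem isSide_right (x : ℝ) : IsSide (𝓝[>] x) x := Or.inr rfl

theorem IsSide.neBot {l : Filter ℝ} {x : ℝ} (h : IsSide l x) : l.NeBot := by
  rcases h with rfl | rfl <;> infer_instance

theorem IsSide.le_nhdsNE {l : Filter ℝ} {x : ℝ} (h : IsSide l x) : l ≤ 𝓝[≠] x := by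
  rcases h with rfl | rfl
  · exact nhdsWithin_mono _ fun y hy => ne_of_lt hy
  · exact nhdsWithin_mono _ fun y hy => ne_of_gt hy

theorem IsSide.le_nhds {l : Filter ℝ} {x : ℝ} (h : IsSide l x) : l ≤ 𝓝 x :=
  h.le_nhdsNE.trans nhdsWithin_le_nhds

theorem IsSide.eventually_nhds {l : Filter ℝ} {x : ℝ} (h : IsSide l x) {p : ℝ → Prop}
    (hp : ∀ᶠ y in l, p y) : ∀ᶠ y in l, ∀ᶠ z in 𝓝 y, p z := by
  rcases h with rfl | rfl
  · filter_upwards [eventually_eventually_nhdsWithin.2 hp, self_mem_nhdsWithin] with y hy hyx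
    rwa [isOpen_Iio.nhdsWithin_eq hyx] at hy
  · filter_upwards [eventually_eventually_nhdsWithin.2 hp, self_mem_nhdsWithin] with y hy hyx
    rwa [isOpen_Ioi.nhdsWithin_eq hyx] at hy

theorem IsSide.eventually_notMem {l : Filter ℝ} {x : ℝ} (h : IsSide l x) (S : Finset ℝ) :
    ∀ᶠ y in l, y ∉ S := by
  have hc : IsClosed ((S : Set ℝ) \ {x}) := (S.finite_toSet.subset sdiff_subset).isClosed
  have h1 : ∀ᶠ y in 𝓝 x, y ∉ (S : Set ℝ) \ {x} := hc.isOpen_compl.mem_nhds (by simp)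
  filter_upwards [h.le_nhds h1, h.le_nhdsNE self_mem_nhdsWithin] with y hy hyx hyS
  exact hy ⟨hyS, hyx⟩

/-- `f` is smooth off the finite set `S`, and all its derivatives have one-sided limits. -/
structure PiecewiseSmooth (S : Finset ℝ) (f : ℝ → ℂ) : Prop where
  contDiffAt : ∀ x ∉ S, ContDiffAt ℝ ∞ f x
  exists_tendsto : ∀ (l : Filter ℝ) (x : ℝ), IsSide l x → ∀ k : ℕ,
    ∃ z : ℂ, Tendsto (iteratedDeriv k f) l (𝓝 z)

/-- The sequence of the limits of the derivatives of `f` along `l`, to be used for the filters of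
one-sided neighbourhoods and for functions for which these limits exist. -/
def jet (l : Filter ℝ) (f : ℝ → ℂ) (k : ℕ) : ℂ := limUnder l (iteratedDeriv k f)

theorem jet_eq {l : Filter ℝ} {x : ℝ} (hl : IsSide l x) {f : ℝ → ℂ} {k : ℕ} {z : ℂ}
    (h : Tendsto (iteratedDeriv k f) l (𝓝 z)) : jet l f k = z :=
  have := hl.neBot
  h.limUnder_eq

theorem jet_deriv (l : Filter ℝ) (f : ℝ → ℂ) (k : ℕ) : jet l (deriv f) k = jet l f (k + 1) := by
  rw [jet, jet, iteratedDeriv_succ']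

theorem IsSide.eventuallyEq_iteratedDeriv {l : Filter ℝ} {x : ℝ} (hl : IsSide l x) {f g : ℝ → ℂ}
    (h : f =ᶠ[l] g) (k : ℕ) : iteratedDeriv k f =ᶠ[l] iteratedDeriv k g := by
  filter_upwards [hl.eventually_nhds h] with y hy
  exact EventuallyEq.iteratedDeriv_eq k hy

theorem jet_congr {l : Filter ℝ} {x : ℝ} (hl : IsSide l x) {f g : ℝ → ℂ} (h : f =ᶠ[l] g) :
    jet l f = jet l g := by
  funext k
  rw [jet, jet, limUnder, limUnder, map_congr (hl.eventuallyEq_iteratedDeriv h k)]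

theorem tendsto_iteratedDeriv_of_contDiffAt {l : Filter ℝ} {x : ℝ} (hl : l ≤ 𝓝 x) {f : ℝ → ℂ}
    (hf : ContDiffAt ℝ ∞ f x) (k : ℕ) :
    Tendsto (iteratedDeriv k f) l (𝓝 (iteratedDeriv k f x)) := by
  have : ContDiffAt ℝ ∞ (iteratedDeriv k f) x := by
    induction k generalizing f with
    | zero => simpa using hf
    | succ k ih => rw [iteratedDeriv_succ']; exact ih (contDiffAt_deriv hf)
  exact this.continuousAt.tendsto.mono_left hl

theorem jet_of_contDiffAt {l : Filter ℝ} {x : ℝ} (hl : IsSide l x) {f : ℝ → ℂ}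
    (hf : ContDiffAt ℝ ∞ f x) : jet l f = fun k => iteratedDeriv k f x :=
  funext fun k => jet_eq hl (tendsto_iteratedDeriv_of_contDiffAt hl.le_nhds hf k)

theorem locallyIntegrable_of_bounded {f : ℝ → ℂ} (hf : AEStronglyMeasurable f volume)
    (hb : ∀ K : Set ℝ, IsCompact K → ∃ M : ℝ, ∀ x ∈ K, ‖f x‖ ≤ M) : LocallyIntegrable f := by
  rw [locallyIntegrable_iff]
  intro K hK
  obtain ⟨M, hM⟩ := hb K hK
  exact Measure.integrableOn_of_bounded hK.measure_lt_top.ne hf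
    ((ae_restrict_iff' hK.measurableSet).2 (ae_of_all _ hM))

theorem jet_zero_of_contDiffAt {l : Filter ℝ} {x : ℝ} (hl : IsSide l x) {f : ℝ → ℂ}
    (hf : ContDiffAt ℝ ∞ f x) : jet l f 0 = f x := by
  simp only [jet_of_contDiffAt hl hf, iteratedDeriv_zero]

namespace PiecewiseSmooth

variable {S : Finset ℝ} {f g : ℝ → ℂ} {l : Filter ℝ} {x : ℝ}

theorem tendsto_jet (hf : PiecewiseSmooth S f) (hl : IsSide l x) (k : ℕ) :
    Tendsto (iteratedDeriv k f) l (𝓝 (jet l f k)) := by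
  obtain ⟨z, hz⟩ := hf.exists_tendsto l x hl k
  rwa [jet_eq hl hz]

theorem tendsto_jet_zero (hf : PiecewiseSmooth S f) (hl : IsSide l x) :
    Tendsto f l (𝓝 (jet l f 0)) := by simpa using hf.tendsto_jet hl 0

theorem jet_zero_eq (hf : PiecewiseSmooth S f) (hl : IsSide l x) (hx : x ∉ S) :
    jet l f 0 = f x := jet_zero_of_contDiffAt hl (hf.contDiffAt x hx)

theorem eventually_contDiffAt (hf : PiecewiseSmooth S f) (hl : IsSide l x) :
    ∀ᶠ y in l, ContDiffAt ℝ ∞ f y :=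
  (hl.eventually_notMem S).mono hf.contDiffAt

theorem _root_.EulerBernoulli.piecewiseSmooth_of_contDiff (S : Finset ℝ) (hf : ContDiff ℝ ∞ f) :
    PiecewiseSmooth S f :=
  ⟨fun _ _ => hf.contDiffAt, fun _ _ hl k =>
    ⟨_, tendsto_iteratedDeriv_of_contDiffAt hl.le_nhds hf.contDiffAt k⟩⟩

theorem mono (hf : PiecewiseSmooth S f) {S' : Finset ℝ} (h : S ⊆ S') : PiecewiseSmooth S' f :=
  ⟨fun x hx => hf.contDiffAt x fun hxS => hx (h hxS), hf.exists_tendsto⟩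

theorem deriv (hf : PiecewiseSmooth S f) : PiecewiseSmooth S (deriv f) :=
  ⟨fun x hx => contDiffAt_deriv (hf.contDiffAt x hx), fun l x hl k => by
    rw [← iteratedDeriv_succ']; exact hf.exists_tendsto l x hl (k + 1)⟩

theorem tendsto_iteratedDeriv_add (hf : PiecewiseSmooth S f) (hg : PiecewiseSmooth S g)
    (hl : IsSide l x) (k : ℕ) :
    Tendsto (iteratedDeriv k fun y => f y + g y) l (𝓝 (jet l f k + jet l g k)) := by
  refine ((hf.tendsto_jet hl k).add (hg.tendsto_jet hl k)).congr' ?_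
  filter_upwards [hf.eventually_contDiffAt hl, hg.eventually_contDiffAt hl] with y h1 h2
  exact (iteratedDeriv_fun_add (h1.of_le (by exact_mod_cast le_top))
    (h2.of_le (by exact_mod_cast le_top))).symm

theorem add (hf : PiecewiseSmooth S f) (hg : PiecewiseSmooth S g) :
    PiecewiseSmooth S fun y => f y + g y :=
  ⟨fun x hx => (hf.contDiffAt x hx).add (hg.contDiffAt x hx), fun _ _ hl k =>
    ⟨_, tendsto_iteratedDeriv_add hf hg hl k⟩⟩

theorem jet_add (hf : PiecewiseSmooth S f) (hg : PiecewiseSmooth S g) (hl : IsSide l x) :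
    jet l (fun y => f y + g y) = fun k => jet l f k + jet l g k :=
  funext fun k => jet_eq hl (tendsto_iteratedDeriv_add hf hg hl k)

theorem mul (hf : PiecewiseSmooth S f) (hg : PiecewiseSmooth S g) :
    PiecewiseSmooth S fun y => f y * g y := by
  refine ⟨fun x hx => (hf.contDiffAt x hx).mul (hg.contDiffAt x hx), fun l x hl k =>
    ⟨∑ i ∈ Finset.range (k + 1), (k.choose i : ℂ) * jet l f i * jet l g (k - i), ?_⟩⟩
  refine (tendsto_finsetSum (Finset.range (k + 1)) fun i _ =>
    ((hf.tendsto_jet hl i).const_mul (k.choose i : ℂ)).mul (hg.tendsto_jet hl (k - i))).congr' ?_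
  filter_upwards [hf.eventually_contDiffAt hl, hg.eventually_contDiffAt hl] with y h1 h2
  exact (iteratedDeriv_fun_mul (h1.of_le (by exact_mod_cast le_top))
    (h2.of_le (by exact_mod_cast le_top))).symm

theorem jet_mul_zero (hf : PiecewiseSmooth S f) (hg : PiecewiseSmooth S g) (hl : IsSide l x) :
    jet l (fun y => f y * g y) 0 = jet l f 0 * jet l g 0 := by
  refine jet_eq hl ?_
  simpa using (hf.tendsto_jet_zero hl).mul (hg.tendsto_jet_zero hl)

theorem const_mul (hf : PiecewiseSmooth S f) (c : ℂ) : PiecewiseSmooth S fun y => c * f y :=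
  (piecewiseSmooth_of_contDiff S contDiff_const).mul hf

theorem hasDerivAt (hf : PiecewiseSmooth S f) (hx : x ∉ S) :
    HasDerivAt f (_root_.deriv f x) x :=
  ((hf.contDiffAt x hx).differentiableAt (by simp)).hasDerivAt

theorem deriv_mul (hf : PiecewiseSmooth S f) (hg : PiecewiseSmooth S g) (hx : x ∉ S) :
    _root_.deriv (fun y => f y * g y) x = _root_.deriv f x * g x + f x * _root_.deriv g x :=
  ((hf.hasDerivAt hx).mul (hg.hasDerivAt hx)).deriv

theorem jet_mul_one (hf : PiecewiseSmooth S f) (hg : PiecewiseSmooth S g) (hl : IsSide l x) :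
    jet l (fun y => f y * g y) 1 = jet l f 1 * jet l g 0 + jet l f 0 * jet l g 1 := by
  rw [← jet_deriv, jet_congr hl (g := fun y => _root_.deriv f y * g y + f y * _root_.deriv g y),
    (hf.deriv.mul hg).jet_add (hf.mul hg.deriv) hl]
  · simp only
    rw [hf.deriv.jet_mul_zero hg hl, hf.jet_mul_zero hg.deriv hl, jet_deriv, jet_deriv]
  · exact (hl.eventually_notMem S).mono fun y hy => hf.deriv_mul hg hy

theorem ae_notMem (S : Finset ℝ) : ∀ᵐ x : ℝ, x ∉ S :=
  S.finite_toSet.countable.ae_notMem volume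

theorem aestronglyMeasurable (hf : PiecewiseSmooth S f) : AEStronglyMeasurable f volume := by
  have h1 : AEStronglyMeasurable f (volume.restrict (S : Set ℝ)ᶜ) :=
    ContinuousOn.aestronglyMeasurable
      (fun x hx => (hf.contDiffAt x hx).continuousAt.continuousWithinAt)
      S.finite_toSet.measurableSet.compl
  rwa [Measure.restrict_eq_self_of_ae_mem] at h1
  exact ae_notMem S

/-- A piecewise smooth function is bounded on compact sets. -/
theorem exists_bound (hf : PiecewiseSmooth S f) {K : Set ℝ} (hK : IsCompact K) :
    ∃ M : ℝ, ∀ x ∈ K, ‖f x‖ ≤ M := by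
  refine hK.induction_on (p := fun K => ∃ M : ℝ, ∀ x ∈ K, ‖f x‖ ≤ M) ⟨0, by simp⟩
    (fun s t hst ⟨M, hM⟩ => ⟨M, fun x hx => hM x (hst hx)⟩)
    (fun s t ⟨M, hM⟩ ⟨N, hN⟩ => ⟨max M N, fun x hx => ?_⟩) fun x _ => ?_
  · rcases hx with hx | hx
    · exact (hM x hx).trans (le_max_left _ _)
    · exact (hN x hx).trans (le_max_right _ _)
  · have hb : ∀ l, IsSide l x → ∃ M : ℝ, ∀ᶠ y in l, ‖f y‖ ≤ M := fun l hl =>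
      ⟨‖jet l f 0‖ + 1, (hf.tendsto_jet_zero hl).norm.eventually_le_const (by linarith)⟩
    obtain ⟨M, hM⟩ := hb _ (isSide_left x)
    obtain ⟨N, hN⟩ := hb _ (isSide_right x)
    refine ⟨{y | ‖f y‖ ≤ max (max M N) ‖f x‖}, mem_nhdsWithin_of_mem_nhds ?_, _, fun y hy => hy⟩
    have hnh : 𝓝 x = 𝓝[<] x ⊔ 𝓝[>] x ⊔ pure x := by
      rw [nhdsLT_sup_nhdsGT, nhdsNE_sup_pure]
    rw [hnh]
    refine mem_sup.2 ⟨mem_sup.2 ⟨?_, ?_⟩, ?_⟩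
    · filter_upwards [hM] with y hy
      exact hy.trans ((le_max_left _ _).trans (le_max_left _ _))
    · filter_upwards [hN] with y hy
      exact hy.trans ((le_max_right _ _).trans (le_max_left _ _))
    · simp

theorem locallyIntegrable (hf : PiecewiseSmooth S f) : LocallyIntegrable f :=
  locallyIntegrable_of_bounded hf.aestronglyMeasurable fun _ hK => hf.exists_bound hK

end PiecewiseSmooth

theorem IsPiecewiseSmooth.exists_piecewiseSmooth {f : ℝ → ℂ} (hf : IsPiecewiseSmooth f) :
    ∃ S : Finset ℝ, PiecewiseSmooth S f := by
  obtain ⟨S, hS, h1, h2⟩ := hf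
  refine ⟨hS.toFinset, fun x hx => h1 x (by simpa using hx), fun l x hl k => ?_⟩
  by_cases hx : x ∈ S
  · rcases hl with rfl | rfl
    · exact (h2 x hx k).1
    · exact (h2 x hx k).2
  · exact ⟨_, tendsto_iteratedDeriv_of_contDiffAt hl.le_nhds (h1 x hx) k⟩

theorem PiecewiseSmooth.isPiecewiseSmooth {S : Finset ℝ} {f : ℝ → ℂ} (hf : PiecewiseSmooth S f) :
    IsPiecewiseSmooth f :=
  ⟨S, S.finite_toSet, fun x hx => hf.contDiffAt x hx, fun x _ k =>
    ⟨hf.exists_tendsto _ x (isSide_left x) k, hf.exists_tendsto _ x (isSide_right x) k⟩⟩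

/-! ### The derivative of a piecewise smooth function -/

/-- The indicator function of `(s, ∞)`. -/
def heaviside (s : ℝ) : ℝ → ℂ := (Ioi s).indicator fun _ => 1

theorem locallyIntegrable_heaviside (s : ℝ) : LocallyIntegrable (heaviside s) :=
  (locallyIntegrable_const 1).indicator measurableSet_Ioi

theorem D_regular_heaviside (s : ℝ) : D (regular (heaviside s)) = dirac s := by
  ext t
  rw [D_apply, regular_apply (locallyIntegrable_heaviside s), coe_testDeriv, dirac_apply]
  have h1 : ∀ x, heaviside s x * deriv t x = (Ioi s).indicator (deriv t) x := fun x => by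
    by_cases hx : x ∈ Ioi s <;> simp [heaviside, hx]
  simp_rw [h1]
  rw [integral_indicator measurableSet_Ioi, HasCompactSupport.integral_Ioi_deriv_eq
    (t.contDiff.of_le (by simp)) t.hasCompactSupport, neg_neg]

/-- Integration by parts for a continuous function that is differentiable off a finite set. -/
theorem D_regular_of_continuous {S : Finset ℝ} {g g' : ℝ → ℂ} (hg : Continuous g)
    (hg' : LocallyIntegrable g') (h : ∀ x ∉ S, HasDerivAt g (g' x) x) :
    D (regular g) = regular g' := by
  ext t
  rw [D_apply, regular_apply hg.locallyIntegrable, regular_apply hg', coe_testDeriv]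
  obtain ⟨r, hr, hrt⟩ : ∃ r > 0, tsupport t ⊆ Ioo (-r) r := by
    obtain ⟨r, hr⟩ := t.hasCompactSupport.isBounded.subset_ball 0
    refine ⟨max r 1, by positivity, hr.trans fun x hx => ?_⟩
    rw [Real.ball_eq_Ioo, zero_sub, zero_add] at hx
    exact ⟨(neg_le_neg (le_max_left r 1)).trans_lt hx.1, hx.2.trans_le (le_max_left r 1)⟩
  have hts : ∀ x ∉ Ioo (-r) r, t x = 0 := fun x hx =>
    image_eq_zero_of_notMem_tsupport fun h => hx (hrt h)
  have hi1 := integrable_mul_test hg' t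
  have hi2 : Integrable fun x => g x * deriv t x := by
    simpa [coe_testDeriv] using integrable_mul_test hg.locallyIntegrable (testDeriv t)
  have hint : Integrable fun x => g' x * t x + g x * deriv t x := hi1.add hi2
  have key := intervalIntegral.integral_eq_integral_of_support_subset (μ := volume)
    (f := fun x => g' x * t x + g x * deriv t x) (a := -r) (b := r) (fun x hx => by
      refine Ioo_subset_Ioc_self (by_contra fun hxr => hx ?_)
      have h2 : deriv t x = 0 :=
        image_eq_zero_of_notMem_tsupport fun h => hxr (hrt (tsupport_deriv_subset h))
      simp [hts x hxr, h2])
  rw [MeasureTheory.integral_eq_of_hasDerivAt_off_countable (fun x => g x * t x) _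
    (s := S) S.finite_toSet.countable (hg.mul t.continuous).continuousOn
    (fun x hx => (h x hx.2).mul
      ((t.contDiff.differentiable (by simp)).differentiableAt.hasDerivAt))
    hint.intervalIntegrable, hts r (by simp), hts (-r) (by simp), integral_add hi1 hi2] at key
  simp only [mul_zero, sub_zero] at key
  linear_combination key

/-- The jump formula: `f' + ∑ₛ (f(s+) - f(s-)) δₛ` is the distributional derivative of `f`. -/
theorem D_regular {S : Finset ℝ} {f : ℝ → ℂ} (hf : PiecewiseSmooth S f) :
    D (regular f) = regular (deriv f) +
      ∑ s ∈ S, (jet (𝓝[>] s) f 0 - jet (𝓝[<] s) f 0) • dirac s := by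
  set J : ℝ → ℂ := fun s => jet (𝓝[>] s) f 0 - jet (𝓝[<] s) f 0 with hJ
  have hJ0 : ∀ x ∉ S, J x = 0 := fun x hx => by
    simp [hJ, hf.jet_zero_eq (isSide_left x) hx, hf.jet_zero_eq (isSide_right x) hx]
  -- subtracting the jumps leaves a continuous function
  set g : ℝ → ℂ := fun x => jet (𝓝[<] x) f 0 - ∑ s ∈ S, J s * heaviside s x with hg
  have hgf : ∀ x ∉ S, g x = f x - ∑ s ∈ S, J s * heaviside s x := fun x hx => by
    simp [hg, hf.jet_zero_eq (isSide_left x) hx]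
  have hleft : ∀ s x, Tendsto (heaviside s) (𝓝[<] x) (𝓝 (heaviside s x)) := fun s x => by
    refine tendsto_const_nhds.congr' ?_
    rcases lt_or_ge s x with h | h
    · filter_upwards [nhdsWithin_le_nhds (Ioi_mem_nhds h)] with y hy
      simp only [mem_Ioi] at hy
      simp [heaviside, h, hy]
    · filter_upwards [self_mem_nhdsWithin] with y hy
      have : ¬ s < y := not_lt.2 ((le_of_lt hy).trans h)
      simp [heaviside, not_lt.2 h, this]
  have hright : ∀ s x, Tendsto (heaviside s) (𝓝[>] x)
      (𝓝 (heaviside s x + if s = x then 1 else 0)) := fun s x => by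
    refine tendsto_const_nhds.congr' ?_
    rcases le_or_gt s x with h | h
    · filter_upwards [self_mem_nhdsWithin] with y hy
      have hsy : s < y := h.trans_lt hy
      rcases h.eq_or_lt with rfl | h
      · simp [heaviside, hsy]
      · simp [heaviside, hsy, h, h.ne]
    · filter_upwards [nhdsWithin_le_nhds (Iio_mem_nhds h)] with y hy
      simp only [mem_Iio] at hy
      simp [heaviside, not_lt.2 h.le, not_lt.2 hy.le, h.ne']
  have hgc : Continuous g := by
    refine continuous_iff_continuousAt.2 fun x =>
      continuousAt_iff_continuous_left'_right'.2 ⟨?_, ?_⟩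
    · refine ((hf.tendsto_jet_zero (isSide_left x)).sub (tendsto_finsetSum S fun s _ =>
        (hleft s x).const_mul (J s))).congr' ?_
      exact ((isSide_left x).eventually_notMem S).mono fun y hy => (hgf y hy).symm
    · have h1 : g x = jet (𝓝[>] x) f 0 -
          ∑ s ∈ S, J s * (heaviside s x + if s = x then 1 else 0) := by
        simp only [hg, mul_add, Finset.sum_add_distrib, mul_ite, mul_one, mul_zero,
          Finset.sum_ite_eq']
        have : (if x ∈ S then J x else 0) = jet (𝓝[>] x) f 0 - jet (𝓝[<] x) f 0 := by
          split_ifs with hx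
          · rfl
          · exact (hJ0 x hx).symm
        rw [this]; ring
      rw [ContinuousWithinAt, h1]
      refine ((hf.tendsto_jet_zero (isSide_right x)).sub (tendsto_finsetSum S fun s _ =>
        (hright s x).const_mul (J s))).congr' ?_
      exact ((isSide_right x).eventually_notMem S).mono fun y hy => (hgf y hy).symm
  have hgd : ∀ x ∉ S, HasDerivAt g (deriv f x) x := fun x hx => by
    have hev : ∀ᶠ y in 𝓝 x, y ∉ S := S.finite_toSet.isClosed.isOpen_compl.mem_nhds hx
    have hconst : (fun y => ∑ s ∈ S, J s * heaviside s y) =ᶠ[𝓝 x]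
        fun _ => ∑ s ∈ S, J s * heaviside s x := by
      have : ∀ s ∈ S, ∀ᶠ y in 𝓝 x, heaviside s y = heaviside s x := fun s hs => by
        rcases lt_or_gt_of_ne (fun h : s = x => hx (h ▸ hs)) with h | h
        · filter_upwards [Ioi_mem_nhds h] with y hy
          simp only [mem_Ioi] at hy
          simp [heaviside, h, hy]
        · filter_upwards [Iio_mem_nhds h] with y hy
          simp only [mem_Iio] at hy
          simp [heaviside, not_lt.2 h.le, not_lt.2 hy.le]
      filter_upwards [(Finset.eventually_all S).2 this] with y hy
      exact Finset.sum_congr rfl fun s hs => by rw [hy s hs]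
    have h1 : HasDerivAt (fun y => f y - ∑ s ∈ S, J s * heaviside s x) (deriv f x) x :=
      (hf.hasDerivAt hx).sub_const _
    refine h1.congr_of_eventuallyEq ?_
    filter_upwards [hev, hconst] with y hy hy'
    rw [hgf y hy, hy']
  have hsumloc : ∀ T : Finset ℝ, LocallyIntegrable (fun x => ∑ s ∈ T, J s * heaviside s x) ∧
      regular (fun x => ∑ s ∈ T, J s * heaviside s x) = ∑ s ∈ T, J s • regular (heaviside s) := by
    intro T
    induction T using Finset.induction_on with
    | empty => simpa using ⟨locallyIntegrable_const 0, regular_zero⟩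
    | insert a T ha ih =>
      simp only [Finset.sum_insert ha]
      have hli : LocallyIntegrable fun x => J a * heaviside a x :=
        (locallyIntegrable_heaviside a).smul (J a)
      exact ⟨hli.add ih.1, by
        rw [regular_add hli ih.1, ih.2, regular_const_mul (locallyIntegrable_heaviside a)]⟩
  have hreg : regular f = regular g + ∑ s ∈ S, J s • regular (heaviside s) := by
    rw [← (hsumloc S).2, ← regular_add hgc.locallyIntegrable (hsumloc S).1]
    refine regular_congr hf.locallyIntegrable (hgc.locallyIntegrable.add (hsumloc S).1) ?_
    filter_upwards [PiecewiseSmooth.ae_notMem S] with x hx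
    rw [hgf x hx]; ring
  rw [hreg, D_add, D_regular_of_continuous hgc hf.deriv.locallyIntegrable hgd, D_sum]
  simp only [D_smul, D_regular_heaviside, hJ]

/-! ### Piecewise smooth functions with point distributions, and their products -/

/-- The sum of a regular distribution and of distributions at the points of `S`, those at `s`
being encoded by the polynomial `c s`. -/
def pw (S : Finset ℝ) (f : ℝ → ℂ) (c : ℝ → ℂ[X]) : Distr :=
  regular f + ∑ s ∈ S, deltaPoly s (c s)

theorem pw_apply {S : Finset ℝ} {f : ℝ → ℂ} (hf : LocallyIntegrable f) (c : ℝ → ℂ[X]) (t : Test) :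
    pw S f c t = (∫ x, f x * t x) + ∑ s ∈ S, evalJet s t (c s) := by
  rw [pw, add_apply, regular_apply hf, sum_apply]
  simp only [deltaPoly_apply]

theorem pw_congr {S : Finset ℝ} {f g : ℝ → ℂ} {c d : ℝ → ℂ[X]} (hf : PiecewiseSmooth S f)
    (hg : PiecewiseSmooth S g) (hfg : ∀ x ∉ S, f x = g x) (hcd : ∀ s ∈ S, c s = d s) :
    pw S f c = pw S g d := by
  rw [pw, pw, Finset.sum_congr rfl fun s hs => by rw [hcd s hs],
    regular_congr hf.locallyIntegrable hg.locallyIntegrable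
      ((PiecewiseSmooth.ae_notMem S).mono hfg)]

theorem pw_add {S : Finset ℝ} {f g : ℝ → ℂ} (hf : PiecewiseSmooth S f)
    (hg : PiecewiseSmooth S g) (c d : ℝ → ℂ[X]) :
    pw S f c + pw S g d = pw S (fun x => f x + g x) fun s => c s + d s := by
  simp only [pw, regular_add hf.locallyIntegrable hg.locallyIntegrable, map_add,
    Finset.sum_add_distrib]
  abel

theorem smul_pw {S : Finset ℝ} {f : ℝ → ℂ} (hf : PiecewiseSmooth S f) (c : ℝ → ℂ[X]) (z : ℂ) :
    z • pw S f c = pw S (fun x => z * f x) fun s => C z * c s := by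
  simp only [pw, regular_const_mul hf.locallyIntegrable, smul_add, Finset.smul_sum, ← map_smul,
    smul_eq_C_mul]

theorem D_pw {S : Finset ℝ} {f : ℝ → ℂ} (hf : PiecewiseSmooth S f) (c : ℝ → ℂ[X]) :
    D (pw S f c) = pw S (deriv f)
      fun s => X * c s + C (jet (𝓝[>] s) f 0 - jet (𝓝[<] s) f 0) := by
  simp only [pw, D_add, D_sum, D_regular hf, map_add, deltaPoly_X_mul, deltaPoly_C,
    Finset.sum_add_distrib]
  abel

theorem coe_translateTestCLM (ε : ℝ) (t : Test) :
    ⇑(translateTestCLM ε t) = fun x => t (x - ε) := rfl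

theorem evalJet_comp_sub (s ε : ℝ) (u : ℝ → ℂ) (p : ℂ[X]) :
    evalJet s (fun x => u (x - ε)) p = evalJet (s - ε) u p := by
  have : ∀ j, iteratedDeriv j (fun x => u (x - ε)) s = iteratedDeriv j u (s - ε) := fun j => by
    simpa [sub_eq_add_neg] using congrFun (iteratedDeriv_comp_add_const j u (-ε)) s
  simp only [evalJet, this]

theorem shiftDistr_pw_apply {S : Finset ℝ} {g : ℝ → ℂ} (hg : LocallyIntegrable g)
    (d : ℝ → ℂ[X]) (ε : ℝ) (t : Test) :
    shiftDistr ε (pw S g d) t =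
      (∫ x, g (x + ε) * t x) + ∑ s ∈ S, evalJet (s - ε) t (d s) := by
  rw [shiftDistr, ContinuousLinearMap.comp_apply, pw_apply hg, coe_translateTestCLM]
  simp only [evalJet_comp_sub]
  rw [← integral_add_right_eq_self (fun x => g x * t (x - ε)) ε]
  simp

theorem evalJet_eq_zero {s : ℝ} {t : Test} (hs : s ∉ tsupport t) (p : ℂ[X]) :
    evalJet s t p = 0 := by
  rw [← deltaPoly_apply, deltaPoly_apply_eq_zero hs]

section Star

variable {S : Finset ℝ} {f g : ℝ → ℂ}

theorem locallyIntegrable_mul_shift (hf : PiecewiseSmooth S f) (hg : PiecewiseSmooth S g)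
    (ε : ℝ) : LocallyIntegrable fun x => f x * g (x + ε) := by
  refine locallyIntegrable_of_bounded (hf.aestronglyMeasurable.mul
    (hg.aestronglyMeasurable.comp_measurePreserving (measurePreserving_add_right volume ε)))
    fun K hK => ?_
  obtain ⟨M, hM⟩ := hf.exists_bound hK
  obtain ⟨N, hN⟩ := hg.exists_bound (hK.image (continuous_add_const ε))
  refine ⟨M * N, fun x hx => ?_⟩
  rw [norm_mul]
  exact mul_le_mul (hM x hx) (hN _ ⟨x, hx, rfl⟩) (norm_nonneg _)
    ((norm_nonneg _).trans (hM x hx))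

/-- The product of `pw S f c` by the translate of `pw S g d` by `ε`. -/
def shiftProd (S : Finset ℝ) (f g : ℝ → ℂ) (c d : ℝ → ℂ[X]) (ε : ℝ) : Distr :=
  regular (fun x => f x * g (x + ε)) +
    ∑ s ∈ S, deltaPoly s (mulJet (fun k => iteratedDeriv k g (s + ε)) (c s)) +
    ∑ s ∈ S, deltaPoly (s - ε) (mulJet (fun k => iteratedDeriv k f (s - ε)) (d s))

theorem shiftProd_apply (hf : PiecewiseSmooth S f) (hg : PiecewiseSmooth S g) (c d : ℝ → ℂ[X])
    (ε : ℝ) (t : Test) : shiftProd S f g c d ε t =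
      (∫ x, f x * g (x + ε) * t x) +
      ∑ s ∈ S, evalJet s t (mulJet (fun k => iteratedDeriv k g (s + ε)) (c s)) +
      ∑ s ∈ S, evalJet (s - ε) t (mulJet (fun k => iteratedDeriv k f (s - ε)) (d s)) := by
  rw [shiftProd, add_apply, add_apply, regular_apply (locallyIntegrable_mul_shift hf hg ε),
    sum_apply, sum_apply]
  simp only [deltaPoly_apply]

/-- For small `ε` the singular points of the two factors are distinct, and the complements of both
sets of singular points cover the line. -/
theorem isHormanderProduct_shiftProd (hf : PiecewiseSmooth S f) (hg : PiecewiseSmooth S g)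
    (c d : ℝ → ℂ[X]) {ε : ℝ} (hε : ∀ s ∈ S, s + ε ∉ S) :
    IsHormanderProduct (pw S f c) (shiftDistr ε (pw S g d)) (shiftProd S f g c d ε) := by
  have hε' : ∀ s ∈ S, s - ε ∉ S := fun s hs h => hε _ h (by simpa using hs)
  have hSo : IsOpen ((S : Set ℝ)ᶜ) := S.finite_toSet.isClosed.isOpen_compl
  have hgε : ∀ x, x + ε ∉ S → ContDiffAt ℝ ∞ (fun y => g (y + ε)) x := fun x hx =>
    (hg.contDiffAt _ hx).comp x (contDiffAt_id.add contDiffAt_const)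
  refine ⟨2, ![{x | x + ε ∈ (S : Set ℝ)ᶜ}, (S : Set ℝ)ᶜ], ?_, ?_, ?_⟩
  · intro i
    fin_cases i
    · exact hSo.preimage (continuous_add_const ε)
    · exact hSo
  · refine eq_univ_of_forall fun x => mem_iUnion.2 ?_
    by_cases hx : x ∈ S
    · exact ⟨0, by simpa using hε x hx⟩
    · exact ⟨1, by simpa using hx⟩
  · intro i
    fin_cases i
    · refine Or.inl ⟨fun x => g (x + ε), ⟨fun x hx => ?_, fun t ht => ?_⟩, fun t u ht hu => ?_⟩
      · exact (hgε x hx).contDiffWithinAt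
      · rw [shiftDistr_pw_apply hg.locallyIntegrable, Finset.sum_eq_zero, add_zero]
        refine fun s hs => evalJet_eq_zero (fun h => ?_) _
        exact ht h (by simpa using hs)
      · have hu' : (u : ℝ → ℂ) = fun x => g (x + ε) * t x := funext hu
        rw [shiftProd_apply hf hg, pw_apply hf.locallyIntegrable, hu',
          Finset.sum_eq_zero (s := S) (f := fun s => evalJet (s - ε) t _), add_zero]
        · congr 1
          · exact integral_congr_ae (ae_of_all _ fun x => by ring_nf)
          · refine Finset.sum_congr rfl fun s hs => ?_
            rw [← evalJet_mulJet (hgε s (hε s hs)) t.contDiff.contDiffAt]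
            simp only [iteratedDeriv_comp_add_const]
        · refine fun s hs => evalJet_eq_zero (fun h => ?_) _
          exact ht h (by simpa using hs)
    · refine Or.inr ⟨f, ⟨fun x hx => ?_, fun t ht => ?_⟩, fun t u ht hu => ?_⟩
      · exact (hf.contDiffAt x hx).contDiffWithinAt
      · rw [pw_apply hf.locallyIntegrable, Finset.sum_eq_zero, add_zero]
        exact fun s hs => evalJet_eq_zero (fun h => ht h hs) _
      · have hu' : (u : ℝ → ℂ) = fun x => f x * t x := funext hu
        rw [shiftProd_apply hf hg, shiftDistr_pw_apply hg.locallyIntegrable, hu',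
          Finset.sum_eq_zero (s := S) (f := fun s => evalJet s t _), add_zero]
        · congr 1
          · exact integral_congr_ae (ae_of_all _ fun x => by ring_nf)
          · refine Finset.sum_congr rfl fun s hs => ?_
            rw [← evalJet_mulJet (hf.contDiffAt _ (hε' s hs)) t.contDiff.contDiffAt]
        · exact fun s hs => evalJet_eq_zero (fun h => ht h hs) _

/-- The coefficient at `s` of the product of `pw S f c` by `pw S g d`: the point distributions of
the first factor see the right limits of the second one, and those of the second factor see the
left limits of the first one. -/
def starCoeff (f g : ℝ → ℂ) (c d : ℝ → ℂ[X]) (s : ℝ) : ℂ[X] :=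
  mulJet (jet (𝓝[>] s) g) (c s) + mulJet (jet (𝓝[<] s) f) (d s)

theorem tendsto_integral_mul_shift (hf : PiecewiseSmooth S f) (hg : PiecewiseSmooth S g)
    (t : Test) : Tendsto (fun ε => ∫ x, f x * g (x + ε) * t x) (𝓝[>] 0)
      (𝓝 (∫ x, f x * g x * t x)) := by
  obtain ⟨r, hr⟩ := t.hasCompactSupport.isBounded.subset_closedBall 0
  rw [Real.closedBall_eq_Icc, zero_sub, zero_add] at hr
  obtain ⟨M, hM⟩ := hf.exists_bound (isCompact_Icc (a := -r) (b := r))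
  obtain ⟨N, hN⟩ := hg.exists_bound (isCompact_Icc (a := -r) (b := r + 1))
  refine tendsto_integral_filter_of_dominated_convergence (fun x => M * N * ‖t x‖) ?_ ?_ ?_ ?_
  · exact Eventually.of_forall fun ε =>
      (integrable_mul_test (locallyIntegrable_mul_shift hf hg ε) t).aestronglyMeasurable
  · filter_upwards [Ioo_mem_nhdsGT (zero_lt_one' ℝ)] with ε hε
    refine ae_of_all _ fun x => ?_
    by_cases hx : x ∈ tsupport t
    · have h1 := hM x (hr hx)
      have h2 := hN (x + ε) ⟨by linarith [(hr hx).1, hε.1], by linarith [(hr hx).2, hε.2]⟩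
      rw [norm_mul, norm_mul]
      gcongr
      exact (norm_nonneg _).trans h1
    · simp [image_eq_zero_of_notMem_tsupport hx]
  · exact (t.continuous.integrable_of_hasCompactSupport t.hasCompactSupport).norm.const_mul _
  · filter_upwards [PiecewiseSmooth.ae_notMem S] with x hx
    have h1 : Tendsto (fun ε : ℝ => x + ε) (𝓝[>] 0) (𝓝 x) := by
      simpa using (tendsto_const_nhds (x := x)).add
        (tendsto_id.mono_left nhdsWithin_le_nhds : Tendsto id (𝓝[>] (0 : ℝ)) (𝓝 0))
    exact (((hg.contDiffAt x hx).continuousAt.tendsto.comp h1).const_mul _).mul_const _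

theorem isStarProduct_pw (hf : PiecewiseSmooth S f) (hg : PiecewiseSmooth S g)
    (c d : ℝ → ℂ[X]) :
    IsStarProduct (pw S f c) (pw S g d) (pw S (fun x => f x * g x) (starCoeff f g c d)) := by
  have hplus : ∀ s : ℝ, Tendsto (fun ε : ℝ => s + ε) (𝓝[>] 0) (𝓝[>] s) := fun s => by
    refine tendsto_nhdsWithin_iff.2 ⟨?_, ?_⟩
    · simpa using (tendsto_const_nhds (x := s)).add
        (tendsto_id.mono_left nhdsWithin_le_nhds : Tendsto id (𝓝[>] (0 : ℝ)) (𝓝 0))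
    · filter_upwards [self_mem_nhdsWithin] with ε hε
      simpa using hε
  have hminus : ∀ s : ℝ, Tendsto (fun ε : ℝ => s - ε) (𝓝[>] 0) (𝓝[<] s) := fun s => by
    refine tendsto_nhdsWithin_iff.2 ⟨?_, ?_⟩
    · simpa using (tendsto_const_nhds (x := s)).sub
        (tendsto_id.mono_left nhdsWithin_le_nhds : Tendsto id (𝓝[>] (0 : ℝ)) (𝓝 0))
    · filter_upwards [self_mem_nhdsWithin] with ε hε
      simpa using hε
  refine ⟨shiftProd S f g c d, ?_, fun t => ?_⟩
  · have : ∀ᶠ ε in 𝓝[>] (0 : ℝ), ∀ s ∈ S, s + ε ∉ S :=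
      (Finset.eventually_all S).2 fun s _ =>
        (hplus s).eventually ((isSide_right s).eventually_notMem S)
    exact this.mono fun ε hε => isHormanderProduct_shiftProd hf hg c d hε
  · have h1 : pw S (fun x => f x * g x) (starCoeff f g c d) t =
        (∫ x, f x * g x * t x) + ∑ s ∈ S, deltaPoly s (mulJet (jet (𝓝[>] s) g) (c s)) t +
          ∑ s ∈ S, deltaPoly s (mulJet (jet (𝓝[<] s) f) (d s)) t := by
      rw [pw_apply (hf.mul hg).locallyIntegrable]
      simp only [starCoeff, map_add, Finset.sum_add_distrib, deltaPoly_apply]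
      ring
    rw [h1]
    simp only [shiftProd_apply hf hg, ← deltaPoly_apply]
    refine ((tendsto_integral_mul_shift hf hg t).add (tendsto_finsetSum S fun s _ => ?_)).add
      (tendsto_finsetSum S fun s _ => ?_)
    · exact tendsto_deltaPoly_mulJet tendsto_const_nhds _
        (fun k => (hg.tendsto_jet (isSide_right s) k).comp (hplus s)) t
    · exact tendsto_deltaPoly_mulJet ((hminus s).mono_right nhdsWithin_le_nhds) _
        (fun k => (hf.tendsto_jet (isSide_left s) k).comp (hminus s)) t

theorem starProd_pw (hf : PiecewiseSmooth S f) (hg : PiecewiseSmooth S g) (c d : ℝ → ℂ[X]) :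
    starProd (pw S f c) (pw S g d) = pw S (fun x => f x * g x) (starCoeff f g c d) :=
  (isStarProduct_pw hf hg c d).starProd_eq

/-- The Leibniz rule for the product of representable distributions. -/
theorem D_starProd_pw (hf : PiecewiseSmooth S f) (hg : PiecewiseSmooth S g) (c d : ℝ → ℂ[X]) :
    D (starProd (pw S f c) (pw S g d)) =
      starProd (D (pw S f c)) (pw S g d) + starProd (pw S f c) (D (pw S g d)) := by
  rw [D_pw hf, D_pw hg, starProd_pw hf hg, starProd_pw hf.deriv hg, starProd_pw hf hg.deriv,
    D_pw (hf.mul hg), pw_add (hf.deriv.mul hg) (hf.mul hg.deriv)]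
  refine pw_congr (hf.mul hg).deriv ((hf.deriv.mul hg).add (hf.mul hg.deriv))
    (fun x hx => hf.deriv_mul hg hx) fun s _ => ?_
  have hr := isSide_right s
  have hl := isSide_left s
  simp only [starCoeff, map_add, mulJet_C, mulJet_X_mul, hf.jet_mul_zero hg hr,
    hf.jet_mul_zero hg hl, map_sub, map_mul]
  have e1 : (fun k => jet (𝓝[>] s) g (k + 1)) = jet (𝓝[>] s) (deriv g) :=
    funext fun k => (jet_deriv _ g k).symm
  have e2 : (fun k => jet (𝓝[<] s) f (k + 1)) = jet (𝓝[<] s) (deriv f) :=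
    funext fun k => (jet_deriv _ f k).symm
  rw [e1, e2]
  ring

end Star

/-! ### Representation of the elements of `𝒜` -/

/-- Every element of `𝒜` is the sum of a piecewise smooth function and of point distributions. -/
theorem exists_eq_pw {F : Distr} (hF : F ∈ spaceA) (T : Finset ℝ) :
    ∃ (S : Finset ℝ) (f : ℝ → ℂ) (c : ℝ → ℂ[X]), T ⊆ S ∧ PiecewiseSmooth S f ∧ F = pw S f c := by
  obtain ⟨f, hf, n, rfl⟩ := hF
  obtain ⟨S, hS⟩ := hf.exists_piecewiseSmooth
  refine ⟨S ∪ T, ?_⟩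
  induction n with
  | zero => exact ⟨f, 0, Finset.subset_union_right, hS.mono Finset.subset_union_left, by simp [pw]⟩
  | succ n ih =>
    obtain ⟨g, c, hT, hg, h⟩ := ih
    exact ⟨_, _, hT, hg.deriv, by rw [Function.iterate_succ_apply', h, D_pw hg]⟩

theorem regular_mem_spaceA {S : Finset ℝ} {f : ℝ → ℂ} (hf : PiecewiseSmooth S f) :
    regular f ∈ spaceA := ⟨f, hf.isPiecewiseSmooth, 0, rfl⟩

/-! ### Point distributions and order -/

theorem tendsto_integral_mul_dilation {k ψ : ℝ → ℂ} (hk : LocallyIntegrable k)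
    (hψ : Continuous ψ) (hs : ∀ x, 1 < |x| → ψ x = 0) (s : ℝ) :
    Tendsto (fun r : ℝ => ∫ x, k x * ψ (r⁻¹ * (x - s))) (𝓝[>] 0) (𝓝 0) := by
  have hc : HasCompactSupport ψ := HasCompactSupport.intro (isCompact_Icc (a := -1) (b := 1))
    fun x hx => hs x (by by_contra h; exact hx (abs_le.1 (not_lt.1 h)))
  obtain ⟨M, hM⟩ := hψ.bounded_above_of_compact_support hc
  have hz : ∀ r : ℝ, 0 < r → ∀ x, r < |x - s| → ψ (r⁻¹ * (x - s)) = 0 := fun r hr x hx =>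
    hs _ (by rw [abs_mul, abs_of_pos (inv_pos.2 hr), ← div_eq_inv_mul, one_lt_div hr]; exact hx)
  have := tendsto_integral_filter_of_dominated_convergence (μ := volume) (l := 𝓝[>] (0 : ℝ))
    (F := fun r x => k x * ψ (r⁻¹ * (x - s))) (f := fun _ => 0)
    (fun x => (Metric.closedBall s 1).indicator (fun x => M * ‖k x‖) x) ?_ ?_ ?_ ?_
  · simpa using this
  · refine Eventually.of_forall fun r => ?_
    exact hk.aestronglyMeasurable.mul (Continuous.aestronglyMeasurable (by fun_prop))
  · filter_upwards [Ioo_mem_nhdsGT (zero_lt_one' ℝ)] with r hr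
    refine ae_of_all _ fun x => ?_
    by_cases hx : x ∈ Metric.closedBall s 1
    · rw [indicator_of_mem hx, norm_mul, mul_comm]
      gcongr
      exact hM _
    · rw [indicator_of_notMem hx, hz r hr.1 x, mul_zero, norm_zero]
      rw [Metric.mem_closedBall, Real.dist_eq, not_le] at hx
      exact hr.2.trans hx
  · rw [integrable_indicator_iff Metric.isClosed_closedBall.measurableSet]
    exact ((hk.integrableOn_isCompact (isCompact_closedBall s 1)).norm).const_mul M
  · filter_upwards [(countable_singleton s).ae_notMem volume] with x hx
    refine tendsto_const_nhds.congr' ?_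
    filter_upwards [Ioo_mem_nhdsGT (abs_pos.2 (sub_ne_zero.2 hx))] with r hr
    rw [hz r hr.1 x hr.2, mul_zero]

/-- There is a test function that coincides with a given power near the origin. -/
theorem exists_smooth_eq_pow (N : ℕ) : ∃ θ : ℝ → ℂ, ContDiff ℝ ∞ θ ∧ (∀ x, 1 < |x| → θ x = 0) ∧
    θ =ᶠ[𝓝 0] fun x => (x : ℂ) ^ N := by
  let χ : ContDiffBump (0 : ℝ) := ⟨1 / 2, 1, by norm_num, by norm_num⟩
  refine ⟨fun x => (x : ℂ) ^ N * (χ x : ℝ), ?_, fun x hx => ?_, ?_⟩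
  · exact (Complex.ofRealCLM.contDiff.pow N).mul (Complex.ofRealCLM.contDiff.comp χ.contDiff)
  · have h0 : χ x = 0 := χ.zero_of_le_dist (by simpa using hx.le)
    simp [h0]
  · filter_upwards [χ.eventuallyEq_one] with x hx
    rw [hx]; simp

theorem iteratedDeriv_ofReal_pow (N j : ℕ) :
    iteratedDeriv j (fun x : ℝ => (x : ℂ) ^ N) 0 = if j = N then (N.factorial : ℂ) else 0 := by
  induction j generalizing N with
  | zero => cases N <;> simp
  | succ j ih =>
    rw [iteratedDeriv_succ']
    cases N with
    | zero => simp
    | succ N =>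
      have hd : deriv (fun x : ℝ => (x : ℂ) ^ (N + 1)) =
          fun x : ℝ => ((N + 1 : ℕ) : ℂ) * (x : ℂ) ^ N := by
        ext x
        simpa using ((hasDerivAt_pow (N + 1) (x : ℂ)).comp_ofReal).deriv
      have hc : ContDiffAt ℝ j (fun x : ℝ => (x : ℂ) ^ N) 0 :=
        (Complex.ofRealCLM.contDiff.pow N).contDiffAt
      rw [hd, iteratedDeriv_const_mul _ hc, ih, Nat.factorial_succ]
      split_ifs <;> simp_all

theorem iteratedDeriv_dilation {θ : ℝ → ℂ} (hθ : ContDiff ℝ ∞ θ) (r s : ℝ) (j : ℕ) (x : ℝ) :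
    iteratedDeriv j (fun y => θ (r⁻¹ * (y - s))) x =
      (r : ℂ)⁻¹ ^ j * iteratedDeriv j θ (r⁻¹ * (x - s)) := by
  have h1 := congrFun (iteratedDeriv_comp_add_const j (fun z => θ (r⁻¹ * z)) (-s)) x
  simp only [← sub_eq_add_neg] at h1
  rw [h1, iteratedDeriv_comp_const_smul (hθ.of_le (by exact_mod_cast le_top))]
  simp only [Complex.real_smul]
  push_cast
  rfl

/-- A point distribution in the `n`-th derivative of a locally integrable function has only
derivatives of the Dirac measure of order less than `n`. -/
theorem coeff_eq_zero_of_eq_iterate_D {S : Finset ℝ} {f h : ℝ → ℂ} {c : ℝ → ℂ[X]} {n : ℕ}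
    (hf : LocallyIntegrable f) (hh : LocallyIntegrable h) (heq : pw S f c = D^[n] (regular h))
    {s : ℝ} (hs : s ∈ S) {j : ℕ} (hj : n ≤ j) : (c s).coeff j = 0 := by
  by_contra hne
  set N := (c s).natDegree with hN
  have hnN : n ≤ N := hj.trans (le_natDegree_of_ne_zero hne)
  have hlead : (c s).coeff N ≠ 0 := by
    rw [hN, coeff_natDegree, Ne, leadingCoeff_eq_zero]
    rintro h0
    simp [h0] at hne
  -- test functions concentrating at `s`, whose only nonzero derivative at `s` is the `N`-th
  obtain ⟨θ, hθ, hθs, hθN⟩ := exists_smooth_eq_pow N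
  have hθn : ∀ x, 1 < |x| → iteratedDeriv n θ x = 0 := fun x hx => by
    have : θ =ᶠ[𝓝 x] fun _ => 0 := by
      filter_upwards [(isOpen_lt continuous_const continuous_abs).mem_nhds hx] with y hy
      exact hθs y hy
    simp [this.iteratedDeriv_eq]
  have hlim := ((tendsto_integral_mul_dilation hh (hθ.continuous_iteratedDeriv n
      (by exact_mod_cast le_top)) hθn s).mul
      (((Complex.continuous_ofReal.tendsto 0).mono_left nhdsWithin_le_nhds :
        Tendsto (fun r : ℝ => (r : ℂ)) (𝓝[>] 0) _).pow (N - n))).const_mul ((-1 : ℂ) ^ n) |>.sub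
    ((tendsto_integral_mul_dilation hf hθ.continuous hθs s).mul
      (((Complex.continuous_ofReal.tendsto 0).mono_left nhdsWithin_le_nhds :
        Tendsto (fun r : ℝ => (r : ℂ)) (𝓝[>] 0) _).pow N))
  rw [zero_mul, zero_mul, mul_zero, sub_zero] at hlim
  have hconst : (c s).coeff N * ((-1) ^ N * (N.factorial : ℂ)) = 0 := by
    refine tendsto_nhds_unique_of_eventuallyEq tendsto_const_nhds hlim ?_
    have hsmall : ∀ᶠ r in 𝓝[>] (0 : ℝ), ∀ s' ∈ S, s' ≠ s → r < |s' - s| :=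
      (Finset.eventually_all S).2 fun s' _ => by
        by_cases h : s' = s
        · simp [h]
        · filter_upwards [Ioo_mem_nhdsGT (abs_pos.2 (sub_ne_zero.2 h))] with r hr _ using hr.2
    filter_upwards [hsmall, self_mem_nhdsWithin] with r hr hr0
    rw [mem_Ioi] at hr0
    have hz : ∀ x, r < |x - s| → θ (r⁻¹ * (x - s)) = 0 := fun x hx =>
      hθs _ (by rw [abs_mul, abs_of_pos (inv_pos.2 hr0), ← div_eq_inv_mul, one_lt_div hr0]
                exact hx)
    have htc : ContDiff ℝ ∞ fun x => θ (r⁻¹ * (x - s)) :=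
      hθ.comp (contDiff_const.mul (contDiff_id.sub contDiff_const))
    have hcs : HasCompactSupport fun x => θ (r⁻¹ * (x - s)) :=
      HasCompactSupport.intro (isCompact_closedBall s r) fun x hx => hz x (by
        rwa [Metric.mem_closedBall, Real.dist_eq, not_le] at hx)
    set t : Test := mkTest _ htc hcs with ht
    have hsupp : tsupport t ⊆ Metric.closedBall s r :=
      closure_minimal (fun x hx => by
        by_contra h
        rw [Metric.mem_closedBall, Real.dist_eq, not_le] at h
        exact hx (hz x h)) Metric.isClosed_closedBall
    have key := congrArg (fun F : Distr => F t) heq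
    simp only [pw_apply hf, iterate_D_apply, regular_apply hh, coe_iterate_testDeriv] at key
    rw [Finset.sum_eq_single_of_mem s hs fun s' hs' hne => evalJet_eq_zero (fun h => by
      have := hsupp h
      rw [Metric.mem_closedBall, Real.dist_eq] at this
      exact absurd (hr s' hs' hne) (not_lt.2 this)) _] at key
    have hder : ∀ j x, iteratedDeriv j t x = (r : ℂ)⁻¹ ^ j * iteratedDeriv j θ (r⁻¹ * (x - s)) :=
      fun j x => iteratedDeriv_dilation hθ r s j x
    have hjet : evalJet s t (c s) =
        (c s).coeff N * ((-1) ^ N * ((r : ℂ)⁻¹ ^ N * (N.factorial : ℂ))) := by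
      have h1 : ∀ j, iteratedDeriv j t s =
          if j = N then (r : ℂ)⁻¹ ^ N * (N.factorial : ℂ) else 0 := fun j => by
        rw [hder, sub_self, mul_zero, hθN.iteratedDeriv_eq, iteratedDeriv_ofReal_pow]
        split_ifs with hjN
        · rw [hjN]
        · simp
      conv_lhs => rw [(c s).as_sum_range_C_mul_X_pow]
      rw [map_sum, Finset.sum_eq_single_of_mem N (by simp [hN])]
      · rw [C_mul_X_pow_eq_monomial, evalJet_monomial, h1, if_pos rfl]
      · intro j _ hjN
        rw [C_mul_X_pow_eq_monomial, evalJet_monomial, h1, if_neg hjN]; simp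
    have hr' : (r : ℂ) ≠ 0 := Complex.ofReal_ne_zero.2 hr0.ne'
    have hI : (∫ x, h x * iteratedDeriv n t x) =
        (r : ℂ)⁻¹ ^ n * ∫ x, h x * iteratedDeriv n θ (r⁻¹ * (x - s)) := by
      rw [← integral_const_mul]
      exact integral_congr_ae (ae_of_all _ fun x => by simp only [hder]; ring)
    rw [hjet, hI] at key
    have hpow : (r : ℂ) ^ N = (r : ℂ) ^ (N - n) * (r : ℂ) ^ n := by
      rw [← pow_add, Nat.sub_add_cancel hnN]
    have e1 : (r : ℂ)⁻¹ ^ N * (r : ℂ) ^ N = 1 := by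
      rw [← mul_pow, inv_mul_cancel₀ hr', one_pow]
    have e2 : (r : ℂ)⁻¹ ^ n * (r : ℂ) ^ n = 1 := by
      rw [← mul_pow, inv_mul_cancel₀ hr', one_pow]
    have key2 := congrArg (fun z => z * (r : ℂ) ^ N) key
    simp only [add_mul] at key2
    set I₁ := ∫ x, h x * iteratedDeriv n θ (r⁻¹ * (x - s))
    set I₂ := ∫ x, f x * θ (r⁻¹ * (x - s))
    have hI2 : (∫ x, f x * t x) = I₂ := rfl
    rw [hI2] at key2
    linear_combination key2 - (c s).coeff N * (-1) ^ N * (N.factorial : ℂ) * e1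
      + (-1) ^ n * (r : ℂ)⁻¹ ^ n * I₁ * hpow + (-1) ^ n * I₁ * (r : ℂ) ^ (N - n) * e2
  rw [mul_eq_zero, mul_eq_zero] at hconst
  rcases hconst with h | h | h
  · exact hlead h
  · simp at h
  · exact Nat.factorial_ne_zero N (by exact_mod_cast h)

/-- The representation by a piecewise smooth function and point distributions is unique. -/
theorem pw_eq_zero {S : Finset ℝ} {f : ℝ → ℂ} {c : ℝ → ℂ[X]} (hf : PiecewiseSmooth S f)
    (h : pw S f c = 0) : (∀ x ∉ S, f x = 0) ∧ ∀ s ∈ S, c s = 0 := by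
  have hc : ∀ s ∈ S, c s = 0 := fun s hs => by
    ext j
    rw [coeff_zero]
    refine coeff_eq_zero_of_eq_iterate_D (n := 0) hf.locallyIntegrable
      (locallyIntegrable_const 0) ?_ hs (Nat.zero_le j)
    rw [h, Function.iterate_zero_apply, regular_zero]
  refine ⟨fun x hx => ?_, hc⟩
  have h0 : regular f = 0 := by
    rw [pw, Finset.sum_eq_zero fun s hs => by rw [hc s hs, map_zero], add_zero] at h
    exact h
  have hae := ae_eq_zero_of_regular_eq_zero hf.locallyIntegrable h0
  have hSo : IsOpen ((S : Set ℝ)ᶜ) := S.finite_toSet.isClosed.isOpen_compl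
  exact Measure.eqOn_open_of_ae_eq (ae_restrict_of_ae hae) hSo
    (fun y hy => (hf.contDiffAt y hy).continuousAt.continuousWithinAt) continuousOn_const hx

theorem coeff_eq_zero_of_ord_le {S : Finset ℝ} {f : ℝ → ℂ} {c : ℝ → ℂ[X]} {n : ℕ}
    (hf : PiecewiseSmooth S f) (h : ord (pw S f c) ≤ n) {s : ℝ} (hs : s ∈ S) {j : ℕ}
    (hj : n ≤ j) : (c s).coeff j = 0 := by
  have hne : {m : ℕ∞ | ∃ n : ℕ, m = n ∧ ∃ g : ℝ → ℂ, LocallyIntegrable g volume ∧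
      pw S f c = D^[n] (regular g)}.Nonempty := by
    by_contra hemp
    rw [not_nonempty_iff_eq_empty] at hemp
    rw [ord, hemp, sInf_empty, top_le_iff] at h
    exact ENat.natCast_ne_top n h
  obtain ⟨m, hm, g, hg, heq⟩ := csInf_mem hne
  rw [ord, hm] at h
  exact coeff_eq_zero_of_eq_iterate_D hf.locallyIntegrable hg heq hs
    ((by exact_mod_cast h : m ≤ n).trans hj)

/-! ### Linear differential equations -/

section LinearODE

variable {E : Type*} [NormedAddCommGroup E] [NormedSpace ℝ E]

/-- The terms of the Picard series for `y' = A y`, `y t₀ = y₀`. -/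
def picardTerm (A : ℝ → E →L[ℝ] E) (t₀ : ℝ) (y₀ : E) : ℕ → ℝ → E
  | 0 => fun _ => y₀
  | n + 1 => fun t => ∫ τ in t₀..t, A τ (picardTerm A t₀ y₀ n τ)

variable {A : ℝ → E →L[ℝ] E}

theorem continuous_picardTerm (hA : Continuous A) (t₀ : ℝ) (y₀ : E) (n : ℕ) :
    Continuous (picardTerm A t₀ y₀ n) := by
  induction n with
  | zero => exact continuous_const
  | succ n ih =>
    exact intervalIntegral.continuous_primitive
      (fun a b => (hA.clm_apply ih).intervalIntegrable a b) t₀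

theorem norm_picardTerm_le (t₀ : ℝ) (y₀ : E) {r K : ℝ}
    (hK : ∀ t ∈ Metric.ball t₀ r, ‖A t‖ ≤ K) (n : ℕ) :
    ∀ t ∈ Metric.ball t₀ r,
      ‖picardTerm A t₀ y₀ n t‖ ≤ ‖y₀‖ * (K * |t - t₀|) ^ n / n.factorial := by
  induction n with
  | zero => intro t _; simp [picardTerm]
  | succ n ih =>
    intro t ht
    have hK0 : 0 ≤ K := (norm_nonneg _).trans (hK t ht)
    have hsub : uIoc t₀ t ⊆ Metric.ball t₀ r := by
      refine uIoc_subset_uIcc.trans ?_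
      have hr : 0 < r := dist_nonneg.trans_lt ht
      rw [Real.ball_eq_Ioo] at ht ⊢
      exact OrdConnected.uIcc_subset ordConnected_Ioo ⟨by linarith, by linarith⟩ ht
    calc ‖picardTerm A t₀ y₀ (n + 1) t‖
        ≤ ∫ τ in uIoc t₀ t, K ^ (n + 1) * ‖y₀‖ / n.factorial * |τ - t₀| ^ n := by
          rw [picardTerm, intervalIntegral.norm_intervalIntegral_eq]
          refine norm_integral_le_of_norm_le (Continuous.integrableOn_uIoc (by fun_prop)) ?_
          refine (ae_restrict_mem measurableSet_uIoc).mono fun τ hτ => ?_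
          calc ‖A τ (picardTerm A t₀ y₀ n τ)‖
              ≤ K * (‖y₀‖ * (K * |τ - t₀|) ^ n / n.factorial) :=
                (A τ).le_of_opNorm_le_of_le (hK τ (hsub hτ)) (ih τ (hsub hτ))
            _ = K ^ (n + 1) * ‖y₀‖ / n.factorial * |τ - t₀| ^ n := by rw [mul_pow]; ring
      _ = ‖y₀‖ * (K * |t - t₀|) ^ (n + 1) / (n + 1).factorial := by
          rw [integral_const_mul, integral_pow_abs_sub_uIoc, Nat.factorial_succ, mul_pow]
          push_cast
          field_simp

/-- Global existence for linear differential equations. -/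
theorem exists_linearODE_solution [CompleteSpace E] (hA : Continuous A) (t₀ : ℝ) (y₀ : E) :
    ∃ y : ℝ → E, y t₀ = y₀ ∧ ∀ t, HasDerivAt y (A t (y t)) t := by
  have hzero : ∀ n, picardTerm A t₀ y₀ (n + 1) t₀ = 0 := fun n => by simp [picardTerm]
  refine ⟨fun t => ∑' n, picardTerm A t₀ y₀ n t, ?_, fun t => ?_⟩
  · refine (tsum_eq_single 0 ?_).trans rfl
    intro n hn
    obtain ⟨m, rfl⟩ := Nat.exists_eq_succ_of_ne_zero hn
    exact hzero m
  · set r := |t - t₀| + 1 with hr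
    have htr : t ∈ Metric.ball t₀ r := by
      rw [Metric.mem_ball, Real.dist_eq]; linarith
    obtain ⟨K, hK⟩ := (isCompact_closedBall t₀ r).exists_bound_of_continuousOn hA.continuousOn
    have hK' : ∀ s ∈ Metric.ball t₀ r, ‖A s‖ ≤ K := fun s hs =>
      hK s (Metric.ball_subset_closedBall hs)
    have hK0 : 0 ≤ K := (norm_nonneg _).trans (hK' t htr)
    have hr0 : 0 ≤ r := by positivity
    let g' : ℕ → ℝ → E := fun n s => match n with
      | 0 => 0
      | n + 1 => A s (picardTerm A t₀ y₀ n s)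
    let u : ℕ → ℝ := fun n => match n with
      | 0 => 0
      | n + 1 => K * (‖y₀‖ * ((K * r) ^ n / n.factorial))
    have hbound : ∀ n, ∀ s ∈ Metric.ball t₀ r,
        ‖picardTerm A t₀ y₀ n s‖ ≤ ‖y₀‖ * ((K * r) ^ n / n.factorial) := fun n s hs => by
      refine (norm_picardTerm_le t₀ y₀ hK' n s hs).trans ?_
      rw [mul_div_assoc]
      have : |s - t₀| ≤ r := by
        rw [Metric.mem_ball, Real.dist_eq] at hs; exact hs.le
      gcongr
    have hsum := (Real.summable_pow_div_factorial (K * r)).mul_left ‖y₀‖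
    have hu : Summable u := by
      rw [← summable_nat_add_iff 1]
      exact hsum.mul_left K
    have hterm : Summable fun n => picardTerm A t₀ y₀ n t :=
      Summable.of_norm_bounded hsum fun n => hbound n t htr
    have key := hasDerivAt_tsum_of_isPreconnected (g := picardTerm A t₀ y₀) (g' := g') hu
      Metric.isOpen_ball (convex_ball t₀ r).isPreconnected ?_ ?_ htr hterm htr
    · convert key using 1
      rw [Summable.tsum_eq_zero_add]
      · simp only [g', zero_add]
        exact (A t).map_tsum hterm
      · rw [← summable_nat_add_iff 1]
        exact (A t).summable hterm
    · intro n s _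
      cases n with
      | zero => exact hasDerivAt_const s y₀
      | succ n =>
        have hc : Continuous fun τ => A τ (picardTerm A t₀ y₀ n τ) :=
          hA.clm_apply (continuous_picardTerm hA t₀ y₀ n)
        exact intervalIntegral.integral_hasDerivAt_right (hc.intervalIntegrable _ _)
          hc.aestronglyMeasurable.stronglyMeasurableAtFilter hc.continuousAt
    · intro n s hs
      cases n with
      | zero => simp [g', u]
      | succ n => exact (A s).le_of_opNorm_le_of_le (hK' s hs) (hbound n s hs)

/-- Uniqueness for linear differential equations, on an interval. -/
theorem linearODE_unique (hA : Continuous A) {U : Set ℝ} (hUc : U.OrdConnected)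
    {y z : ℝ → E} (hy : ∀ t ∈ U, HasDerivAt y (A t (y t)) t)
    (hz : ∀ t ∈ U, HasDerivAt z (A t (z t)) t) {t₀ : ℝ} (ht₀ : t₀ ∈ U) (h : y t₀ = z t₀) :
    EqOn y z U := by
  intro t ht
  have hsub : uIcc t₀ t ⊆ U := hUc.uIcc_subset ht₀ ht
  obtain ⟨K, hK⟩ := (isCompact_uIcc (a := t₀) (b := t)).exists_bound_of_continuousOn
    hA.continuousOn
  have hlip : ∀ s ∈ uIcc t₀ t, LipschitzOnWith (Real.toNNReal K) (fun x => A s x) univ :=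
    fun s hs => ((A s).lipschitz.weaken (by
      rw [← NNReal.coe_le_coe, coe_nnnorm]
      exact (hK s hs).trans (Real.le_coe_toNNReal K))).lipschitzOnWith
  have hyc : ContinuousOn y (uIcc t₀ t) := fun s hs =>
    (hy s (hsub hs)).continuousAt.continuousWithinAt
  have hzc : ContinuousOn z (uIcc t₀ t) := fun s hs =>
    (hz s (hsub hs)).continuousAt.continuousWithinAt
  rcases le_total t₀ t with hle | hle
  · rw [uIcc_of_le hle] at hsub hlip hyc hzc
    exact ODE_solution_unique_of_mem_Icc_right (v := fun s x => A s x) (s := fun _ => univ)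
      (fun s hs => hlip s (Ico_subset_Icc_self hs)) hyc
      (fun s hs => (hy s (hsub (Ico_subset_Icc_self hs))).hasDerivWithinAt)
      (fun _ _ => trivial) hzc
      (fun s hs => (hz s (hsub (Ico_subset_Icc_self hs))).hasDerivWithinAt)
      (fun _ _ => trivial) h ⟨hle, le_rfl⟩
  · rw [uIcc_of_ge hle] at hsub hlip hyc hzc
    exact ODE_solution_unique_of_mem_Icc_left (v := fun s x => A s x) (s := fun _ => univ)
      (fun s hs => hlip s (Ioc_subset_Icc_self hs)) hyc
      (fun s hs => (hy s (hsub (Ioc_subset_Icc_self hs))).hasDerivWithinAt)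
      (fun _ _ => trivial) hzc
      (fun s hs => (hz s (hsub (Ioc_subset_Icc_self hs))).hasDerivWithinAt)
      (fun _ _ => trivial) h ⟨le_rfl, hle⟩

end LinearODE

/-! ### The beam equation with smooth coefficients -/

/-- `u` is a smooth solution of `(a u'')'' = q u` on the whole line. -/
structure IsBeamSolution (a q u : ℝ → ℂ) : Prop where
  contDiff : ContDiff ℝ ∞ u
  eq : ∀ x, deriv (deriv fun y => a y * deriv (deriv u) y) x = q x * u x

/-- The vector field of the first order system for `(u, u', a u'', (a u'')')`, with `c = a⁻¹`. -/
def beamField (c q : ℝ → ℂ) (t : ℝ) : (Fin 4 → ℂ) →L[ℝ] (Fin 4 → ℂ) :=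
  ContinuousLinearMap.pi ![.proj 1, 0, .proj 3, 0] +
    c t • ContinuousLinearMap.pi ![0, .proj 2, 0, 0] +
    q t • ContinuousLinearMap.pi ![0, 0, 0, .proj 0]

theorem beamField_apply (c q : ℝ → ℂ) (t : ℝ) (y : Fin 4 → ℂ) :
    beamField c q t y = ![y 1, c t * y 2, y 3, q t * y 0] := by
  ext i
  fin_cases i <;> simp [beamField]

theorem continuous_beamField {c q : ℝ → ℂ} (hc : Continuous c) (hq : Continuous q) :
    Continuous (beamField c q) :=
  (continuous_const.add (hc.smul continuous_const)).add (hq.smul continuous_const)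

theorem hasDerivAt_beamField_iff {c q : ℝ → ℂ} {y : ℝ → Fin 4 → ℂ} {t : ℝ} :
    HasDerivAt y (beamField c q t (y t)) t ↔
      HasDerivAt (fun s => y s 0) (y t 1) t ∧ HasDerivAt (fun s => y s 1) (c t * y t 2) t ∧
      HasDerivAt (fun s => y s 2) (y t 3) t ∧ HasDerivAt (fun s => y s 3) (q t * y t 0) t := by
  rw [hasDerivAt_pi, beamField_apply]
  simp [Fin.forall_fin_succ]

theorem contDiff_of_beamField {c q : ℝ → ℂ} (hc : ContDiff ℝ ∞ c) (hq : ContDiff ℝ ∞ q)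
    {y : ℝ → Fin 4 → ℂ} (hy : ∀ t, HasDerivAt y (beamField c q t (y t)) t) (i : Fin 4) :
    ContDiff ℝ ∞ fun t => y t i := by
  have h := fun t => hasDerivAt_beamField_iff.1 (hy t)
  have hd : ∀ (n : ℕ) {f g : ℝ → ℂ}, (∀ t, HasDerivAt f (g t) t) → ContDiff ℝ n g →
      ContDiff ℝ (n + 1 : ℕ) f := fun n f g hfg hg => by
    have hfg' : deriv f = g := funext fun t => (hfg t).deriv
    have : ContDiff ℝ ((n : WithTop ℕ∞) + 1) f := contDiff_succ_iff_deriv.2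
      ⟨fun t => (hfg t).differentiableAt, by simp, by rwa [hfg']⟩
    exact_mod_cast this
  have key : ∀ n : ℕ, ∀ i, ContDiff ℝ n fun t => y t i := fun n => by
    induction n with
    | zero =>
      intro i
      have hyc : Continuous y := continuous_iff_continuousAt.2 fun t => (hy t).continuousAt
      exact contDiff_zero.2 ((continuous_apply i).comp hyc)
    | succ n ih =>
      have hc' : ContDiff ℝ n c := hc.of_le (by exact_mod_cast le_top)
      have hq' : ContDiff ℝ n q := hq.of_le (by exact_mod_cast le_top)
      intro i
      fin_cases i
      · exact hd n (fun t => (h t).1) (ih 1)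
      · exact hd n (fun t => (h t).2.1) (hc'.mul (ih 2))
      · exact hd n (fun t => (h t).2.2.1) (ih 3)
      · exact hd n (fun t => (h t).2.2.2) (hq'.mul (ih 0))
  exact contDiff_infty.2 fun n => key n i

section Beam

variable {a q : ℝ → ℂ}

/-- The state `(u, u', a u'', (a u'')')` of a function. -/
def beamState (a u : ℝ → ℂ) (t : ℝ) : Fin 4 → ℂ :=
  ![u t, deriv u t, a t * deriv (deriv u) t, deriv (fun y => a y * deriv (deriv u) y) t]

theorem contDiff_deriv {u : ℝ → ℂ} (hu : ContDiff ℝ ∞ u) : ContDiff ℝ ∞ (deriv u) :=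
  contDiff_iff_contDiffAt.2 fun _ => contDiffAt_deriv hu.contDiffAt

theorem hasDerivAt_of_contDiff {u : ℝ → ℂ} (hu : ContDiff ℝ ∞ u) (t : ℝ) :
    HasDerivAt u (deriv u t) t :=
  (hu.differentiable (by simp)).differentiableAt.hasDerivAt

theorem beamState_apply (ha : ContDiff ℝ ∞ a) {u : ℝ → ℂ} (hu : ContDiff ℝ ∞ u) (t : ℝ) :
    beamState a u t = ![iteratedDeriv 0 u t, iteratedDeriv 1 u t, a t * iteratedDeriv 2 u t,
      deriv a t * iteratedDeriv 2 u t + a t * iteratedDeriv 3 u t] := by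
  have h : deriv (fun y => a y * deriv (deriv u) y) t =
      deriv a t * deriv (deriv u) t + a t * deriv (deriv (deriv u)) t :=
    ((hasDerivAt_of_contDiff ha t).mul
      (hasDerivAt_of_contDiff (contDiff_deriv (contDiff_deriv hu)) t)).deriv
  simp [beamState, h, iteratedDeriv_succ]

theorem IsBeamSolution.hasDerivAt (ha : ContDiff ℝ ∞ a) (ha0 : ∀ x, a x ≠ 0) {u : ℝ → ℂ}
    (hu : IsBeamSolution a q u) (t : ℝ) :
    HasDerivAt (beamState a u) (beamField (fun x => (a x)⁻¹) q t (beamState a u t)) t := by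
  have h1 := contDiff_deriv hu.contDiff
  have h2 := contDiff_deriv h1
  have h3 : ContDiff ℝ ∞ fun y => a y * deriv (deriv u) y := ha.mul h2
  refine hasDerivAt_beamField_iff.2 ⟨hasDerivAt_of_contDiff hu.contDiff t, ?_,
    hasDerivAt_of_contDiff h3 t, ?_⟩
  · have := hasDerivAt_of_contDiff h1 t
    simpa [beamState, ha0 t] using this
  · have := hasDerivAt_of_contDiff (contDiff_deriv h3) t
    rw [hu.eq] at this
    exact this

/-- The initial value problem for the beam equation has a solution on the whole line. -/
theorem exists_isBeamSolution (ha : ContDiff ℝ ∞ a) (ha0 : ∀ x, a x ≠ 0) (hq : ContDiff ℝ ∞ q)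
    (x₀ : ℝ) (C : Fin 4 → ℂ) :
    ∃ u, IsBeamSolution a q u ∧ ∀ k : Fin 4, iteratedDeriv k u x₀ = C k := by
  have hc : ContDiff ℝ ∞ fun x => (a x)⁻¹ := ha.inv ha0
  obtain ⟨y, hy0, hy⟩ := exists_linearODE_solution
    (continuous_beamField hc.continuous hq.continuous) x₀
    ![C 0, C 1, a x₀ * C 2, deriv a x₀ * C 2 + a x₀ * C 3]
  have h := fun t => hasDerivAt_beamField_iff.1 (hy t)
  have hsm := contDiff_of_beamField hc hq hy
  have d0 : deriv (fun t => y t 0) = fun t => y t 1 := funext fun t => (h t).1.deriv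
  have d1 : deriv (fun t => y t 1) = fun t => (a t)⁻¹ * y t 2 := funext fun t => (h t).2.1.deriv
  have d2 : deriv (fun t => y t 2) = fun t => y t 3 := funext fun t => (h t).2.2.1.deriv
  have d3 : deriv (fun t => y t 3) = fun t => q t * y t 0 := funext fun t => (h t).2.2.2.deriv
  have e2 : (fun t => a t * deriv (deriv fun t => y t 0) t) = fun t => y t 2 := by
    rw [d0, d1]
    funext t
    rw [mul_inv_cancel_left₀ (ha0 t)]
  have hu : IsBeamSolution a q fun t => y t 0 := ⟨hsm 0, fun x => by rw [e2, d2, d3]⟩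
  refine ⟨_, hu, ?_⟩
  have hst : beamState a (fun t => y t 0) x₀ = y x₀ := by
    ext i
    fin_cases i
    · rfl
    · simp [beamState, d0]
    · exact congrFun e2 x₀
    · simp [beamState, e2, d2]
  rw [beamState_apply ha (hsm 0), hy0] at hst
  have s0 := congrFun hst 0
  have s1 := congrFun hst 1
  have s2 := congrFun hst 2
  have s3 := congrFun hst 3
  simp only [Matrix.cons_val] at s0 s1 s2 s3
  have s2' := mul_left_cancel₀ (ha0 x₀) s2
  rw [s2'] at s3
  have s3' := mul_left_cancel₀ (ha0 x₀) (add_left_cancel s3)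
  intro k
  fin_cases k
  · exact s0
  · exact s1
  · exact s2'
  · exact s3'

/-- A solution of the beam equation is determined by its jet of order three at a point. -/
theorem IsBeamSolution.unique (ha : ContDiff ℝ ∞ a) (ha0 : ∀ x, a x ≠ 0)
    (hq : ContDiff ℝ ∞ q) {u v : ℝ → ℂ} (hu : IsBeamSolution a q u) (hv : IsBeamSolution a q v)
    {x₀ : ℝ} (h : ∀ k : Fin 4, iteratedDeriv k u x₀ = iteratedDeriv k v x₀) : u = v := by
  have hc : ContDiff ℝ ∞ fun x => (a x)⁻¹ := ha.inv ha0
  have key := linearODE_unique (continuous_beamField hc.continuous hq.continuous)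
    ordConnected_univ (fun t _ => hu.hasDerivAt ha ha0 t) (fun t _ => hv.hasDerivAt ha ha0 t)
    (mem_univ x₀) (by
      rw [beamState_apply ha hu.contDiff, beamState_apply ha hv.contDiff]
      have h0 := h 0
      have h1 := h 1
      have h2 := h 2
      have h3 := h 3
      simp only [Fin.val_zero, Fin.val_one, Fin.val_two] at h0 h1 h2
      have h3' : iteratedDeriv 3 u x₀ = iteratedDeriv 3 v x₀ := h3
      rw [h0, h1, h2, h3'])
  exact funext fun t => congrFun (key (mem_univ t)) 0

/-- If neither `h` nor `h'` jumps at `x`, then the left-continuous version of `h` is differentiable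
at `x`. -/
theorem PiecewiseSmooth.hasDerivAt_leftLim {S : Finset ℝ} {h : ℝ → ℂ} (hh : PiecewiseSmooth S h)
    {x : ℝ} (h0 : jet (𝓝[>] x) h 0 = jet (𝓝[<] x) h 0)
    (h1 : jet (𝓝[>] x) h 1 = jet (𝓝[<] x) h 1) :
    HasDerivAt (fun y => jet (𝓝[<] y) h 0) (jet (𝓝[<] x) h 1) x := by
  set k : ℝ → ℂ := fun y => jet (𝓝[<] y) h 0 with hk
  have hkh : ∀ y ∉ S, k y = h y := fun y hy => hh.jet_zero_eq (isSide_left y) hy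
  have hev : ∀ y ∉ S, k =ᶠ[𝓝 y] h := fun y hy => by
    filter_upwards [S.finite_toSet.isClosed.isOpen_compl.mem_nhds hy] with z hz using hkh z hz
  have hlim : ∀ l, IsSide l x → Tendsto k l (𝓝 (jet l h 0)) ∧
      Tendsto (fun y => _root_.deriv k y) l (𝓝 (jet l h 1)) := fun l hl => by
    constructor
    · exact (hh.tendsto_jet_zero hl).congr'
        ((hl.eventually_notMem S).mono fun y hy => (hkh y hy).symm)
    · refine (hh.tendsto_jet hl 1).congr' ((hl.eventually_notMem S).mono fun y hy => ?_)
      change _ = _root_.deriv k y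
      rw [iteratedDeriv_one, (hev y hy).deriv_eq]
  have hdiff : DifferentiableOn ℝ k {y | y ∉ S} := fun y hy =>
    ((hh.hasDerivAt hy).congr_of_eventuallyEq (hev y hy)).differentiableAt.differentiableWithinAt
  have hl := hlim _ (isSide_left x)
  have hr := hlim _ (isSide_right x)
  rw [h0, h1] at hr
  have hcont : ContinuousAt k x := continuousAt_iff_continuous_left'_right'.2 ⟨hl.1, hr.1⟩
  have hL := hasDerivWithinAt_Iic_of_tendsto_deriv hdiff hcont.continuousWithinAt
    ((isSide_left x).eventually_notMem S) hl.2
  have hR := hasDerivWithinAt_Ici_of_tendsto_deriv hdiff hcont.continuousWithinAt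
    ((isSide_right x).eventually_notMem S) hr.2
  simpa using hL.union hR

/-- The one-sided limits of `α f''` and of its derivative, for `α` equal to a smooth function on
one side. -/
theorem PiecewiseSmooth.jet_mul_deriv_deriv {S : Finset ℝ} {f : ℝ → ℂ}
    (hf : PiecewiseSmooth S f) {α g : ℝ → ℂ} (hg : ContDiff ℝ ∞ g) {l : Filter ℝ} {x : ℝ}
    (hl : IsSide l x) (hα : α =ᶠ[l] g) :
    jet l (fun y => α y * _root_.deriv (_root_.deriv f) y) 0 = g x * jet l f 2 ∧
    jet l (fun y => α y * _root_.deriv (_root_.deriv f) y) 1 =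
      _root_.deriv g x * jet l f 2 + g x * jet l f 3 := by
  have hgS := piecewiseSmooth_of_contDiff S hg
  rw [jet_congr hl (g := fun y => g y * _root_.deriv (_root_.deriv f) y)
    (hα.mono fun y hy => by simp only [hy]), hgS.jet_mul_zero hf.deriv.deriv hl,
    hgS.jet_mul_one hf.deriv.deriv hl, jet_of_contDiffAt hl hg.contDiffAt]
  simp only [jet_deriv, iteratedDeriv_zero, iteratedDeriv_one, zero_add, Nat.reduceAdd, and_self]

/-- A piecewise smooth function without jumps up to order three that solves the beam equation off
its singular points coincides with a smooth solution. -/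
theorem exists_isBeamSolution_eqOn (ha : ContDiff ℝ ∞ a) (ha0 : ∀ x, a x ≠ 0)
    (hq : ContDiff ℝ ∞ q) {S : Finset ℝ} {f : ℝ → ℂ} (hf : PiecewiseSmooth S f) {U : Set ℝ}
    (hU : IsOpen U) (hUc : U.OrdConnected) (hne : U.Nonempty)
    (hjump : ∀ x ∈ U, ∀ k : Fin 4, jet (𝓝[>] x) f k = jet (𝓝[<] x) f k)
    (heq : ∀ x ∈ U, x ∉ S → deriv (deriv fun y => a y * deriv (deriv f) y) x = q x * f x) :
    ∃ u, IsBeamSolution a q u ∧ ∀ x ∈ U, x ∉ S → f x = u x := by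
  obtain ⟨t₀, ht₀⟩ := hne
  have hc : ContDiff ℝ ∞ fun x => (a x)⁻¹ := ha.inv ha0
  obtain ⟨u, hu, hu0⟩ := exists_isBeamSolution ha ha0 hq t₀ fun k => jet (𝓝[<] t₀) f k
  have haS := piecewiseSmooth_of_contDiff S ha
  have hqS := piecewiseSmooth_of_contDiff S hq
  have hf2 := hf.deriv.deriv
  set τ : ℝ → ℂ := fun y => a y * deriv (deriv f) y with hτ
  have hτS : PiecewiseSmooth S τ := haS.mul hf2
  have hτ0 : ∀ {l : Filter ℝ} {x : ℝ}, IsSide l x → jet l τ 0 = a x * jet l f 2 :=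
    fun hl => (hf.jet_mul_deriv_deriv ha hl EventuallyEq.rfl).1
  have hτ1 : ∀ {l : Filter ℝ} {x : ℝ}, IsSide l x →
      jet l τ 1 = deriv a x * jet l f 2 + a x * jet l f 3 :=
    fun hl => (hf.jet_mul_deriv_deriv ha hl EventuallyEq.rfl).2
  have hτ2 : ∀ {l : Filter ℝ} {x : ℝ}, IsSide l x → x ∈ U →
      jet l τ 2 = q x * jet l f 0 := fun {l x} hl hx => by
    rw [← jet_deriv, ← jet_deriv, jet_congr hl (g := fun y => q y * f y),
      hqS.jet_mul_zero hf hl, jet_zero_of_contDiffAt hl hq.contDiffAt]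
    filter_upwards [hl.eventually_notMem S, hl.le_nhds (hU.mem_nhds hx)] with y hy hyU
    exact heq y hyU hy
  have key := linearODE_unique (continuous_beamField hc.continuous hq.continuous) hUc
    (y := fun t => ![jet (𝓝[<] t) f 0, jet (𝓝[<] t) f 1, jet (𝓝[<] t) τ 0, jet (𝓝[<] t) τ 1])
    (z := beamState a u) (fun t ht => hasDerivAt_beamField_iff.2 ?_)
    (fun t _ => hu.hasDerivAt ha ha0 t) ht₀ ?_
  · refine ⟨u, hu, fun x hx hxS => ?_⟩
    rw [← hf.jet_zero_eq (isSide_left x) hxS]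
    exact congrFun (key hx) 0
  · have hl := isSide_left t
    have hr := isSide_right t
    have j0 : jet (𝓝[>] t) f 0 = jet (𝓝[<] t) f 0 := hjump t ht 0
    have j1 : jet (𝓝[>] t) f 1 = jet (𝓝[<] t) f 1 := hjump t ht 1
    have j2 : jet (𝓝[>] t) f 2 = jet (𝓝[<] t) f 2 := hjump t ht 2
    have j3 : jet (𝓝[>] t) f 3 = jet (𝓝[<] t) f 3 := hjump t ht 3
    simp only [Matrix.cons_val]
    refine ⟨hf.hasDerivAt_leftLim j0 j1, ?_, ?_, ?_⟩
    · have := hf.deriv.hasDerivAt_leftLim (x := t) (by simpa only [jet_deriv] using j1)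
        (by simpa only [jet_deriv] using j2)
      simp only [jet_deriv, zero_add, Nat.reduceAdd] at this
      rwa [hτ0 hl, inv_mul_cancel_left₀ (ha0 t)]
    · exact hτS.hasDerivAt_leftLim (by rw [hτ0 hl, hτ0 hr, j2]) (by rw [hτ1 hl, hτ1 hr, j2, j3])
    · have := hτS.deriv.hasDerivAt_leftLim (x := t)
        (by rw [jet_deriv, jet_deriv, zero_add, hτ1 hl, hτ1 hr, j2, j3])
        (by rw [jet_deriv, jet_deriv, hτ2 hl ht, hτ2 hr ht, j0])
      simp only [jet_deriv, zero_add, Nat.reduceAdd] at this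
      rwa [hτ2 hl ht] at this
  · rw [beamState_apply ha hu.contDiff, hτ0 (isSide_left t₀), hτ1 (isSide_left t₀)]
    have e0 := hu0 0
    have e1 := hu0 1
    have e2 := hu0 2
    have e3 : iteratedDeriv 3 u t₀ = jet (𝓝[<] t₀) f 3 := hu0 3
    simp only [Fin.val_zero, Fin.val_one, Fin.val_two] at e0 e1 e2
    rw [e0, e1, e2, e3]

end Beam

/-! ### Functions with a single singular point -/

/-- The function equal to `u` on the left and to `v` on the right of `ξ`. -/
def glue (ξ : ℝ) (u v : ℝ → ℂ) (x : ℝ) : ℂ := (Iio ξ).indicator u x + (Ioi ξ).indicator v x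

theorem glue_of_lt {ξ x : ℝ} (u v : ℝ → ℂ) (h : x < ξ) : glue ξ u v x = u x := by
  simp [glue, h, h.le]

theorem glue_of_gt {ξ x : ℝ} (u v : ℝ → ℂ) (h : ξ < x) : glue ξ u v x = v x := by
  simp [glue, h, h.le]

theorem jet_glue_of_lt {ξ x : ℝ} {u : ℝ → ℂ} (v : ℝ → ℂ) (hu : ContDiff ℝ ∞ u) {l : Filter ℝ}
    (hl : IsSide l x) (h : ∀ᶠ y in l, y < ξ) :
    jet l (glue ξ u v) = fun k => iteratedDeriv k u x := by
  rw [jet_congr hl (h.mono fun y hy => glue_of_lt u v hy), jet_of_contDiffAt hl hu.contDiffAt]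

theorem jet_glue_of_gt {ξ x : ℝ} (u : ℝ → ℂ) {v : ℝ → ℂ} (hv : ContDiff ℝ ∞ v) {l : Filter ℝ}
    (hl : IsSide l x) (h : ∀ᶠ y in l, ξ < y) :
    jet l (glue ξ u v) = fun k => iteratedDeriv k v x := by
  rw [jet_congr hl (h.mono fun y hy => glue_of_gt u v hy), jet_of_contDiffAt hl hv.contDiffAt]

theorem IsSide.eventually_lt {l : Filter ℝ} {x ξ : ℝ} (hl : IsSide l x) (h : x < ξ) :
    ∀ᶠ y in l, y < ξ := hl.le_nhds (Iio_mem_nhds h)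

theorem IsSide.eventually_gt {l : Filter ℝ} {x ξ : ℝ} (hl : IsSide l x) (h : ξ < x) :
    ∀ᶠ y in l, ξ < y := hl.le_nhds (Ioi_mem_nhds h)

theorem eventually_lt_left (ξ : ℝ) : ∀ᶠ y in 𝓝[<] ξ, y < ξ := self_mem_nhdsWithin
theorem eventually_gt_right (ξ : ℝ) : ∀ᶠ y in 𝓝[>] ξ, ξ < y := self_mem_nhdsWithin

theorem piecewiseSmooth_glue {S : Finset ℝ} {ξ : ℝ} (hξ : ξ ∈ S) {u v : ℝ → ℂ}
    (hu : ContDiff ℝ ∞ u) (hv : ContDiff ℝ ∞ v) : PiecewiseSmooth S (glue ξ u v) := by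
  refine ⟨fun x hx => ?_, fun l x hl k => ?_⟩
  · rcases lt_or_gt_of_ne (fun h : x = ξ => hx (h ▸ hξ)) with h | h
    · refine hu.contDiffAt.congr_of_eventuallyEq ?_
      filter_upwards [Iio_mem_nhds h] with y hy using glue_of_lt u v hy
    · refine hv.contDiffAt.congr_of_eventuallyEq ?_
      filter_upwards [Ioi_mem_nhds h] with y hy using glue_of_gt u v hy
  · have hside : (∀ᶠ y in l, y < ξ) ∨ ∀ᶠ y in l, ξ < y := by
      rcases lt_trichotomy x ξ with h | rfl | h
      · exact Or.inl (hl.eventually_lt h)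
      · rcases hl with rfl | rfl
        · exact Or.inl (eventually_lt_left x)
        · exact Or.inr (eventually_gt_right x)
      · exact Or.inr (hl.eventually_gt h)
    rcases hside with h | h
    · exact ⟨_, (tendsto_iteratedDeriv_of_contDiffAt hl.le_nhds hu.contDiffAt k).congr'
        (hl.eventuallyEq_iteratedDeriv (h.mono fun y hy => (glue_of_lt u v hy).symm) k)⟩
    · exact ⟨_, (tendsto_iteratedDeriv_of_contDiffAt hl.le_nhds hv.contDiffAt k).congr'
        (hl.eventuallyEq_iteratedDeriv (h.mono fun y hy => (glue_of_gt u v hy).symm) k)⟩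

/-- The polynomial at `s` of the distribution `∑ⱼ cⱼ δ_ξ^{(j)}`. -/
def pointCoeff {n : ℕ} (ξ : ℝ) (c : Fin n → ℂ) (s : ℝ) : ℂ[X] :=
  if s = ξ then ∑ j : Fin n, C (c j) * X ^ (j : ℕ) else 0

theorem coeff_pointCoeff {n : ℕ} (ξ : ℝ) (c : Fin n → ℂ) (j : Fin n) :
    (pointCoeff ξ c ξ).coeff j = c j := by
  simp only [pointCoeff, if_true, finsetSum_coeff, coeff_C_mul_X_pow]
  rw [Finset.sum_eq_single_of_mem j (Finset.mem_univ j)]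
  · simp
  · intro i _ hij
    rw [if_neg fun h => hij (Fin.ext h.symm)]

theorem natDegree_pointCoeff_le {n : ℕ} (ξ : ℝ) (c : Fin (n + 1) → ℂ) (s : ℝ) :
    (pointCoeff ξ c s).natDegree ≤ n := by
  rw [pointCoeff]
  split_ifs
  · exact natDegree_sum_le_of_forall_le _ _ fun j _ =>
      (natDegree_C_mul_X_pow_le _ _).trans (Nat.le_of_lt_succ j.2)
  · simp

theorem coefficient_eq_pw {n : ℕ} {S : Finset ℝ} {ξ : ℝ} (hξ : ξ ∈ S) (fm fp : ℝ → ℂ)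
    (c : Fin n → ℂ) : coefficient ξ fm fp c = pw S (glue ξ fm fp) (pointCoeff ξ c) := by
  rw [coefficient, pw, Finset.sum_eq_single_of_mem ξ hξ]
  · simp only [pointCoeff, if_true, map_sum, ← smul_eq_C_mul, map_smul, deltaPoly_X_pow]
    rfl
  · intro s _ hs
    rw [pointCoeff, if_neg hs, map_zero]

/-! ### The equation in terms of piecewise smooth functions and point distributions -/

/-- `F` is a piecewise smooth function plus point distributions, with singular points in `S`. -/
def IsPw (S : Finset ℝ) (F : Distr) : Prop :=
  ∃ (f : ℝ → ℂ) (c : ℝ → ℂ[X]), PiecewiseSmooth S f ∧ F = pw S f c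

theorem IsPw.D {S : Finset ℝ} {F : Distr} (hF : IsPw S F) : IsPw S (D F) := by
  obtain ⟨f, c, hf, rfl⟩ := hF
  exact ⟨_, _, hf.deriv, D_pw hf c⟩

theorem D_starProd {S : Finset ℝ} {F G : Distr} (hF : IsPw S F) (hG : IsPw S G) :
    D (starProd F G) = starProd (D F) G + starProd F (D G) := by
  obtain ⟨f, c, hf, rfl⟩ := hF
  obtain ⟨g, d, hg, rfl⟩ := hG
  exact D_starProd_pw hf hg c d

/-- By the Leibniz rule, the principal part of the equation is `(a₀ * φ'' + φ'' * a₁)''`. -/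
theorem sum_starProd_eq {S : Finset ℝ} {a₀ a₁ φ : Distr} (h₀ : IsPw S a₀) (h₁ : IsPw S a₁)
    (hφ : IsPw S φ) :
    ∑ i ∈ Finset.range 3, (Nat.choose 2 i : ℂ) •
        (starProd (D^[i] a₀) (D^[4 - i] φ) + starProd (D^[4 - i] φ) (D^[i] a₁)) =
      D (D (starProd a₀ (D (D φ)) + starProd (D (D φ)) a₁)) := by
  have h2 : IsPw S (D (D φ)) := hφ.D.D
  rw [D_add, D_starProd h₀ h2, D_starProd h2 h₁, D_add, D_add, D_add, D_starProd h₀.D h2,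
    D_starProd h₀ h2.D, D_starProd h2.D h₁, D_starProd h2 h₁.D]
  simp only [Finset.sum_range_succ, Finset.sum_range_zero, Function.iterate_succ,
    Function.iterate_zero, Function.comp_apply, id_eq, Nat.choose_zero_right, Nat.choose_one_right,
    Nat.choose_self, Nat.reduceSub, Nat.cast_one, Nat.cast_ofNat, one_smul, zero_add]
  ext t
  simp only [add_apply, smul_apply, smul_eq_mul]
  ring

theorem sub_smul_eq (F G : Distr) (z : ℂ) : F - z • G = F + (-z) • G := by
  ext t
  simp [sub_eq_add_neg]

theorem pw_eq_zero_iff {S : Finset ℝ} {f : ℝ → ℂ} {c : ℝ → ℂ[X]} (hf : PiecewiseSmooth S f) :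
    pw S f c = 0 ↔ (∀ x ∉ S, f x = 0) ∧ ∀ s ∈ S, c s = 0 := by
  refine ⟨pw_eq_zero hf, fun h => ?_⟩
  rw [pw_congr hf (piecewiseSmooth_of_contDiff S contDiff_const) h.1 h.2 (d := fun _ => 0)]
  simp [pw, regular_zero]

section Equation

variable {S : Finset ℝ} {α₀ α₁ β₀ β₁ f : ℝ → ℂ}

/-- The equality of the polynomials of both sides of the equation at the point `s`, where the
coefficients have polynomials `p₀`, `p₁`, `q₀`, `q₁` and the unknown has polynomial `c`. -/
def PointEquation (α₀ α₁ β₀ β₁ f : ℝ → ℂ) (w : ℂ) (s : ℝ) (p₀ p₁ q₀ q₁ c : ℂ[X]) : Prop :=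
  X * (X * (mulJet (fun k => jet (𝓝[>] s) f (k + 2)) p₀ +
        mulJet (fun k => jet (𝓝[<] s) f (k + 2)) p₁ +
        mulJet (fun k => jet (𝓝[<] s) α₀ k + jet (𝓝[>] s) α₁ k)
          (X * (X * c + C (jet (𝓝[>] s) f 0 - jet (𝓝[<] s) f 0)) +
            C (jet (𝓝[>] s) f 1 - jet (𝓝[<] s) f 1))) +
      C (jet (𝓝[>] s) (fun y => (α₀ y + α₁ y) * deriv (deriv f) y) 0 -
        jet (𝓝[<] s) (fun y => (α₀ y + α₁ y) * deriv (deriv f) y) 0)) +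
    C (jet (𝓝[>] s) (fun y => (α₀ y + α₁ y) * deriv (deriv f) y) 1 -
      jet (𝓝[<] s) (fun y => (α₀ y + α₁ y) * deriv (deriv f) y) 1) =
  C (w ^ 2) * (mulJet (jet (𝓝[>] s) f) q₀ + mulJet (jet (𝓝[<] s) f) q₁ +
    mulJet (fun k => jet (𝓝[<] s) β₀ k + jet (𝓝[>] s) β₁ k) c)

/-- The equation amounts to a differential equation off the singular points and to an equality of
polynomials at each of them. -/
theorem equation_iff (hα₀ : PiecewiseSmooth S α₀) (hα₁ : PiecewiseSmooth S α₁)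
    (hβ₀ : PiecewiseSmooth S β₀) (hβ₁ : PiecewiseSmooth S β₁) (hf : PiecewiseSmooth S f)
    (p₀ p₁ q₀ q₁ c : ℝ → ℂ[X]) (w : ℂ) :
    ∑ i ∈ Finset.range 3, (Nat.choose 2 i : ℂ) •
        (starProd (D^[i] (pw S α₀ p₀)) (D^[4 - i] (pw S f c)) +
          starProd (D^[4 - i] (pw S f c)) (D^[i] (pw S α₁ p₁)))
      - w ^ 2 • (starProd (pw S β₀ q₀) (pw S f c) + starProd (pw S f c) (pw S β₁ q₁)) = 0 ↔
    (∀ x ∉ S, deriv (deriv fun y => (α₀ y + α₁ y) * deriv (deriv f) y) x =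
      w ^ 2 * ((β₀ x + β₁ x) * f x)) ∧
    ∀ s ∈ S, PointEquation α₀ α₁ β₀ β₁ f w s (p₀ s) (p₁ s) (q₀ s) (q₁ s) (c s) := by
  have hτ := (hα₀.add hα₁).mul hf.deriv.deriv
  have hτ' := (hα₀.mul hf.deriv.deriv).add (hf.deriv.deriv.mul hα₁)
  have hτeq : (fun y => α₀ y * deriv (deriv f) y + deriv (deriv f) y * α₁ y) =
      fun y => (α₀ y + α₁ y) * deriv (deriv f) y := by
    funext y; ring
  rw [sum_starProd_eq ⟨α₀, p₀, hα₀, rfl⟩ ⟨α₁, p₁, hα₁, rfl⟩ ⟨f, c, hf, rfl⟩, D_pw hf, D_pw hf.deriv,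
    starProd_pw hα₀ hf.deriv.deriv, starProd_pw hf.deriv.deriv hα₁,
    pw_add (hα₀.mul hf.deriv.deriv) (hf.deriv.deriv.mul hα₁), D_pw hτ', D_pw hτ'.deriv,
    starProd_pw hβ₀ hf, starProd_pw hf hβ₁, pw_add (hβ₀.mul hf) (hf.mul hβ₁), sub_smul_eq,
    smul_pw ((hβ₀.mul hf).add (hf.mul hβ₁)),
    pw_add hτ'.deriv.deriv (((hβ₀.mul hf).add (hf.mul hβ₁)).const_mul _), hτeq,
    pw_eq_zero_iff (hτ.deriv.deriv.add (((hβ₀.mul hf).add (hf.mul hβ₁)).const_mul _))]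
  refine and_congr (forall₂_congr fun x _ => ?_) (forall₂_congr fun s _ => ?_)
  · rw [neg_mul, ← sub_eq_add_neg, sub_eq_zero, mul_comm (f x), ← add_mul]
  · have e1 : jet (𝓝[>] s) (deriv (deriv f)) = fun k => jet (𝓝[>] s) f (k + 2) :=
      funext fun k => by rw [jet_deriv, jet_deriv]
    have e2 : jet (𝓝[<] s) (deriv (deriv f)) = fun k => jet (𝓝[<] s) f (k + 2) :=
      funext fun k => by rw [jet_deriv, jet_deriv]
    rw [map_neg, neg_mul, ← sub_eq_add_neg, sub_eq_zero, PointEquation]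
    simp only [starCoeff, e1, e2, jet_deriv, mulJet_add_jet, zero_add]
    constructor <;> intro h <;> linear_combination h

end Equation

/-- The equation excludes point distributions in the unknown: with `c` of degree `n`, the left side
has degree `n + 4` and the right side has degree at most `max n 3`. -/
theorem PointEquation.eq_zero {α₀ α₁ β₀ β₁ f : ℝ → ℂ} {w : ℂ} {s : ℝ} {p₀ p₁ q₀ q₁ c : ℂ[X]}
    (heq : PointEquation α₀ α₁ β₀ β₁ f w s p₀ p₁ q₀ q₁ c) (hp₀ : p₀.natDegree ≤ 1)
    (hp₁ : p₁.natDegree ≤ 1) (hq₀ : q₀.natDegree ≤ 3) (hq₁ : q₁.natDegree ≤ 3)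
    (hh : jet (𝓝[<] s) α₀ 0 + jet (𝓝[>] s) α₁ 0 ≠ 0) : c = 0 := by
  rw [PointEquation] at heq
  set z₀ := jet (𝓝[>] s) f 0 - jet (𝓝[<] s) f 0
  set z₁ := jet (𝓝[>] s) f 1 - jet (𝓝[<] s) f 1
  by_contra hc
  set n := c.natDegree with hn
  have hΦ : (X * (X * c + C z₀) + C z₁).natDegree ≤ n + 2 := by
    have h1 : (X * c + C z₀).natDegree ≤ n + 1 :=
      (natDegree_add_C).le.trans (by rw [natDegree_X_mul hc])
    rw [natDegree_add_C]
    exact natDegree_mul_le.trans (by rw [natDegree_X]; omega)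
  have hcoef : (X * (X * c + C z₀) + C z₁).coeff (n + 2) = c.leadingCoeff := by
    rw [coeff_add, coeff_X_mul, coeff_add, coeff_X_mul, coeff_C_succ, coeff_C_succ, add_zero,
      add_zero]
    rfl
  have hlow : ∀ (g : ℕ → ℂ) (p : ℂ[X]) (m k : ℕ), p.natDegree ≤ m → m < k →
      (mulJet g p).coeff k = 0 := fun g p m k hp hk =>
    coeff_eq_zero_of_natDegree_lt ((mulJet_degree g m p hp).1.trans_lt hk)
  have key := congrArg (fun p : ℂ[X] => p.coeff (n + 4)) heq
  simp only [coeff_add, coeff_C_mul] at key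
  rw [coeff_X_mul, coeff_C_succ, coeff_add, coeff_X_mul, coeff_C_succ, coeff_add, coeff_add,
    hlow _ p₀ 1 (n + 2) hp₀ (by omega), hlow _ p₁ 1 (n + 2) hp₁ (by omega),
    (mulJet_degree _ (n + 2) _ hΦ).2, hcoef, hlow _ q₀ 3 (n + 4) hq₀ (by omega),
    hlow _ q₁ 3 (n + 4) hq₁ (by omega), hlow _ c n (n + 4) le_rfl (by omega)] at key
  simp [hh, hc] at key

theorem cubic_eq_zero_iff (e₀ e₁ e₂ e₃ : ℂ) :
    C e₀ + X * (C e₁ + X * (C e₂ + X * C e₃)) = 0 ↔ e₀ = 0 ∧ e₁ = 0 ∧ e₂ = 0 ∧ e₃ = 0 := by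
  constructor
  · intro h
    have h0 := congrArg (fun p : ℂ[X] => p.coeff 0) h
    have h1 := congrArg (fun p : ℂ[X] => p.coeff (0 + 1)) h
    have h2 := congrArg (fun p : ℂ[X] => p.coeff (0 + 1 + 1)) h
    have h3 := congrArg (fun p : ℂ[X] => p.coeff (0 + 1 + 1 + 1)) h
    simp only [coeff_add, coeff_X_mul, coeff_C_succ, coeff_zero, coeff_C_zero, coeff_X_mul_zero,
      zero_add, add_zero] at h0 h1 h2 h3
    exact ⟨h0, h1, h2, h3⟩
  · rintro ⟨rfl, rfl, rfl, rfl⟩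
    simp

/-- The equation at a singular point, for an unknown without point distributions there. -/
theorem pointEquation_iff {r l h : ℕ → ℂ} (b : ℕ → ℂ) (A₀ A₁ : Fin 2 → ℂ) (B₀ B₁ : Fin 4 → ℂ)
    (z₂ z₃ z₄ : ℂ) :
    X * (X * (mulJet (fun k => r (k + 2)) (∑ j, C (A₀ j) * X ^ (j : ℕ)) +
        mulJet (fun k => l (k + 2)) (∑ j, C (A₁ j) * X ^ (j : ℕ)) +
        mulJet h (X * (X * 0 + C (r 0 - l 0)) + C (r 1 - l 1))) + C z₂) + C z₃ =
      C z₄ * (mulJet r (∑ j, C (B₀ j) * X ^ (j : ℕ)) + mulJet l (∑ j, C (B₁ j) * X ^ (j : ℕ)) +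
        mulJet b 0) ↔
    z₃ - z₄ * (B₀ 0 * r 0 - B₀ 1 * r 1 + B₀ 2 * r 2 - B₀ 3 * r 3 +
      (B₁ 0 * l 0 - B₁ 1 * l 1 + B₁ 2 * l 2 - B₁ 3 * l 3)) = 0 ∧
    z₂ - z₄ * (B₀ 1 * r 0 - 2 * B₀ 2 * r 1 + 3 * B₀ 3 * r 2 +
      (B₁ 1 * l 0 - 2 * B₁ 2 * l 1 + 3 * B₁ 3 * l 2)) = 0 ∧
    A₀ 0 * r 2 - A₀ 1 * r 3 + (A₁ 0 * l 2 - A₁ 1 * l 3) + h 0 * (r 1 - l 1) - h 1 * (r 0 - l 0) -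
      z₄ * (B₀ 2 * r 0 - 3 * B₀ 3 * r 1 + (B₁ 2 * l 0 - 3 * B₁ 3 * l 1)) = 0 ∧
    A₀ 1 * r 2 + A₁ 1 * l 2 + h 0 * (r 0 - l 0) - z₄ * (B₀ 3 * r 0 + B₁ 3 * l 0) = 0 := by
  rw [← cubic_eq_zero_iff, ← sub_eq_zero]
  have h2 : ∀ c : Fin 2 → ℂ, ∑ j, C (c j) * X ^ (j : ℕ) = C (c 0) + X * C (c 1) := fun c => by
    simp [Fin.sum_univ_succ]
  have h4 : ∀ c : Fin 4 → ℂ, ∑ j, C (c j) * X ^ (j : ℕ) =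
      C (c 0) + X * (C (c 1) + X * (C (c 2) + X * C (c 3))) := fun c => by
    simp [Fin.sum_univ_succ]; ring
  simp only [h2, h4, map_add, mulJet_X_mul, mulJet_C, map_zero, mul_zero, zero_add, map_sub,
    map_mul, Nat.reduceAdd, map_ofNat]
  constructor <;> intro hh <;> linear_combination hh

/-! ### Solutions of the equation -/

section Solutions

variable {ξ : ℝ} {w : ℂ} {am ap bm bp : Fin 2 → ℝ → ℂ} {A : Fin 2 → Fin 2 → ℂ}
  {B : Fin 2 → Fin 4 → ℂ}

theorem contDiff_aSide {u : Fin 2 → ℝ → ℂ} (hu : ∀ i, ContDiff ℝ ∞ (u i)) :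
    ContDiff ℝ ∞ (aSide u) := (hu 0).add (hu 1)

theorem glue_add_glue_of_lt (u v : Fin 2 → ℝ → ℂ) {x : ℝ} (h : x < ξ) :
    glue ξ (u 0) (v 0) x + glue ξ (u 1) (v 1) x = aSide u x := by
  rw [glue_of_lt _ _ h, glue_of_lt _ _ h, aSide]

theorem glue_add_glue_of_gt (u v : Fin 2 → ℝ → ℂ) {x : ℝ} (h : ξ < x) :
    glue ξ (u 0) (v 0) x + glue ξ (u 1) (v 1) x = aSide v x := by
  rw [glue_of_gt _ _ h, glue_of_gt _ _ h, aSide]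

/-- The scalar equations at the interface, in matrix form. -/
theorem interface_iff (l r : ℕ → ℂ) :
    (deriv (aSide ap) ξ * r 2 + aSide ap ξ * r 3 - (deriv (aSide am) ξ * l 2 + aSide am ξ * l 3) -
      w ^ 2 * (B 0 0 * r 0 - B 0 1 * r 1 + B 0 2 * r 2 - B 0 3 * r 3 +
      (B 1 0 * l 0 - B 1 1 * l 1 + B 1 2 * l 2 - B 1 3 * l 3)) = 0 ∧
    aSide ap ξ * r 2 - aSide am ξ * l 2 -
      w ^ 2 * (B 0 1 * r 0 - 2 * B 0 2 * r 1 + 3 * B 0 3 * r 2 +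
      (B 1 1 * l 0 - 2 * B 1 2 * l 1 + 3 * B 1 3 * l 2)) = 0 ∧
    A 0 0 * r 2 - A 0 1 * r 3 + (A 1 0 * l 2 - A 1 1 * l 3) + aMid am ap ξ * (r 1 - l 1) -
      deriv (aMid am ap) ξ * (r 0 - l 0) -
      w ^ 2 * (B 0 2 * r 0 - 3 * B 0 3 * r 1 + (B 1 2 * l 0 - 3 * B 1 3 * l 1)) = 0 ∧
    A 0 1 * r 2 + A 1 1 * l 2 + aMid am ap ξ * (r 0 - l 0) -
      w ^ 2 * (B 0 3 * r 0 + B 1 3 * l 0) = 0) ↔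
    (matA ξ w am ap A B).mulVec (fun k => l k) = (matB ξ w am ap A B).mulVec fun k => r k := by
  rw [funext_iff]
  simp only [Fin.forall_fin_succ, matA, matB, Matrix.mulVec, dotProduct, Fin.sum_univ_four,
    Matrix.of_apply, Matrix.cons_val, Fin.succ_zero_eq_one, Fin.succ_one_eq_two, Fin.reduceSucc,
    Fin.coe_ofNat_eq_mod, Nat.reduceMod, IsEmpty.forall_iff, and_true]
  constructor <;>
  · rintro ⟨h0, h1, h2, h3⟩
    exact ⟨by linear_combination -h0, by linear_combination -h1, by linear_combination -h2,
      by linear_combination -h3⟩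

/-- For an unknown without point distribution at `ξ`, the equation at `ξ` is the interface
condition `𝐀 · (left jet) = 𝐁 · (right jet)`. -/
theorem interface_equation_iff (ham : ∀ i, ContDiff ℝ ∞ (am i)) (hap : ∀ i, ContDiff ℝ ∞ (ap i))
    (β₀ β₁ : ℝ → ℂ) {S : Finset ℝ} {f : ℝ → ℂ} (hf : PiecewiseSmooth S f) :
    PointEquation (glue ξ (am 0) (ap 0)) (glue ξ (am 1) (ap 1)) β₀ β₁ f w ξ
      (pointCoeff ξ (A 0) ξ) (pointCoeff ξ (A 1) ξ) (pointCoeff ξ (B 0) ξ) (pointCoeff ξ (B 1) ξ) 0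
    ↔ (matA ξ w am ap A B).mulVec (fun k => jet (𝓝[<] ξ) f k) =
      (matB ξ w am ap A B).mulVec fun k => jet (𝓝[>] ξ) f k := by
  have hl := isSide_left ξ
  have hr := isSide_right ξ
  have tl := hf.jet_mul_deriv_deriv (contDiff_aSide ham) hl
    (α := fun y => glue ξ (am 0) (ap 0) y + glue ξ (am 1) (ap 1) y)
    ((eventually_lt_left ξ).mono fun y hy => glue_add_glue_of_lt am ap hy)
  have tr := hf.jet_mul_deriv_deriv (contDiff_aSide hap) hr
    (α := fun y => glue ξ (am 0) (ap 0) y + glue ξ (am 1) (ap 1) y)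
    ((eventually_gt_right ξ).mono fun y hy => glue_add_glue_of_gt am ap hy)
  have hd : deriv (aMid am ap) ξ = deriv (am 0) ξ + deriv (ap 1) ξ :=
    ((hasDerivAt_of_contDiff (ham 0) ξ).add (hasDerivAt_of_contDiff (hap 1) ξ)).deriv
  rw [PointEquation, tl.1, tl.2, tr.1, tr.2]
  simp only [pointCoeff, if_true]
  rw [pointEquation_iff, ← interface_iff, jet_glue_of_lt _ (ham 0) hl (eventually_lt_left ξ),
    jet_glue_of_gt _ (hap 1) hr (eventually_gt_right ξ)]
  simp only [iteratedDeriv_zero, iteratedDeriv_one, hd]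
  rfl

/-- At a point where the coefficients are smooth, the unknown and its first three derivatives do not
jump. -/
theorem jet_eq_of_pointEquation {α₀ α₁ β₀ β₁ f g : ℝ → ℂ} {x : ℝ} {S : Finset ℝ}
    (hf : PiecewiseSmooth S f) (hg : ContDiff ℝ ∞ g) (hgx : g x ≠ 0)
    (hα : (fun y => α₀ y + α₁ y) =ᶠ[𝓝 x] g)
    (h0 : jet (𝓝[<] x) α₀ 0 + jet (𝓝[>] x) α₁ 0 = g x)
    (heq : PointEquation α₀ α₁ β₀ β₁ f w x 0 0 0 0 0) (k : Fin 4) :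
    jet (𝓝[>] x) f k = jet (𝓝[<] x) f k := by
  have hl := isSide_left x
  have hr := isSide_right x
  have tl := hf.jet_mul_deriv_deriv hg hl (hl.le_nhds hα)
  have tr := hf.jet_mul_deriv_deriv hg hr (hr.le_nhds hα)
  have h2 : (0 : ℂ[X]) = ∑ j, C ((0 : Fin 2 → ℂ) j) * X ^ (j : ℕ) := by simp
  have h4 : (0 : ℂ[X]) = ∑ j, C ((0 : Fin 4 → ℂ) j) * X ^ (j : ℕ) := by simp
  have key := (pointEquation_iff (r := jet (𝓝[>] x) f) (l := jet (𝓝[<] x) f)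
    (h := fun k => jet (𝓝[<] x) α₀ k + jet (𝓝[>] x) α₁ k)
    (fun k => jet (𝓝[<] x) β₀ k + jet (𝓝[>] x) β₁ k) (0 : Fin 2 → ℂ) 0 (0 : Fin 4 → ℂ) 0
    _ _ (w ^ 2)).1 (by rw [← h2, ← h4]; exact heq)
  simp only [tl.1, tl.2, tr.1, tr.2, h0, Pi.zero_apply, zero_mul, mul_zero, add_zero, sub_zero,
    zero_add] at key
  obtain ⟨e3, e2, e1, e0⟩ := key
  have j0 : jet (𝓝[>] x) f 0 - jet (𝓝[<] x) f 0 = 0 := (mul_eq_zero.1 e0).resolve_left hgx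
  rw [j0, mul_zero, sub_zero] at e1
  have j1 : jet (𝓝[>] x) f 1 - jet (𝓝[<] x) f 1 = 0 := (mul_eq_zero.1 e1).resolve_left hgx
  have j2 : jet (𝓝[>] x) f 2 = jet (𝓝[<] x) f 2 := mul_left_cancel₀ hgx (sub_eq_zero.1 e2)
  rw [j2] at e3
  have j3 : jet (𝓝[>] x) f 3 = jet (𝓝[<] x) f 3 := mul_left_cancel₀ hgx (by
    linear_combination e3)
  fin_cases k
  · exact sub_eq_zero.1 j0
  · exact sub_eq_zero.1 j1
  · exact j2
  · exact j3

/-- The solutions of the equation: pairs of smooth solutions of the beam equations on both sides,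
joined by the interface condition. -/
theorem isSolution_iff (ham : ∀ i, ContDiff ℝ ∞ (am i)) (hap : ∀ i, ContDiff ℝ ∞ (ap i))
    (hbm : ∀ i, ContDiff ℝ ∞ (bm i)) (hbp : ∀ i, ContDiff ℝ ∞ (bp i)) {a b : Fin 2 → Distr}
    (ha : ∀ i, a i = coefficient ξ (am i) (ap i) (A i))
    (hb : ∀ i, b i = coefficient ξ (bm i) (bp i) (B i))
    (hC1 : aMid am ap ξ ≠ 0) (hCm : ∀ x, aSide am x ≠ 0) (hCp : ∀ x, aSide ap x ≠ 0)
    {φ : Distr} :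
    IsSolution a b w φ ↔ ∃ um up : ℝ → ℂ,
      IsBeamSolution (aSide am) (fun x => w ^ 2 * aSide bm x) um ∧
      IsBeamSolution (aSide ap) (fun x => w ^ 2 * aSide bp x) up ∧
      (matA ξ w am ap A B).mulVec (fun k => iteratedDeriv k um ξ) =
        (matB ξ w am ap A B).mulVec (fun k => iteratedDeriv k up ξ) ∧
      φ = regular (glue ξ um up) := by
  have hqm : ContDiff ℝ ∞ fun x => w ^ 2 * aSide bm x := contDiff_const.mul (contDiff_aSide hbm)
  have hqp : ContDiff ℝ ∞ fun x => w ^ 2 * aSide bp x := contDiff_const.mul (contDiff_aSide hbp)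
  constructor
  · rintro ⟨hφ, heq⟩
    obtain ⟨S, f, c, hS, hf, rfl⟩ := exists_eq_pw hφ {ξ}
    have hξ : ξ ∈ S := hS (Finset.mem_singleton_self ξ)
    rw [ha, ha, hb, hb, coefficient_eq_pw hξ, coefficient_eq_pw hξ, coefficient_eq_pw hξ,
      coefficient_eq_pw hξ, equation_iff (piecewiseSmooth_glue hξ (ham 0) (hap 0))
        (piecewiseSmooth_glue hξ (ham 1) (hap 1)) (piecewiseSmooth_glue hξ (hbm 0) (hbp 0))
        (piecewiseSmooth_glue hξ (hbm 1) (hbp 1)) hf] at heq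
    obtain ⟨hode, hpt⟩ := heq
    have hlt : ∀ s < ξ, jet (𝓝[<] s) (glue ξ (am 0) (ap 0)) 0 +
        jet (𝓝[>] s) (glue ξ (am 1) (ap 1)) 0 = aSide am s := fun s hs => by
      rw [jet_glue_of_lt _ (ham 0) (isSide_left s) ((isSide_left s).eventually_lt hs),
        jet_glue_of_lt _ (ham 1) (isSide_right s) ((isSide_right s).eventually_lt hs)]
      rfl
    have hgt : ∀ s, ξ < s → jet (𝓝[<] s) (glue ξ (am 0) (ap 0)) 0 +
        jet (𝓝[>] s) (glue ξ (am 1) (ap 1)) 0 = aSide ap s := fun s hs => by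
      rw [jet_glue_of_gt _ (hap 0) (isSide_left s) ((isSide_left s).eventually_gt hs),
        jet_glue_of_gt _ (hap 1) (isSide_right s) ((isSide_right s).eventually_gt hs)]
      rfl
    have hne : ∀ s, jet (𝓝[<] s) (glue ξ (am 0) (ap 0)) 0 +
        jet (𝓝[>] s) (glue ξ (am 1) (ap 1)) 0 ≠ 0 := fun s => by
      rcases lt_trichotomy s ξ with h | rfl | h
      · rw [hlt s h]; exact hCm s
      · rw [jet_glue_of_lt _ (ham 0) (isSide_left s) (eventually_lt_left s),
          jet_glue_of_gt _ (hap 1) (isSide_right s) (eventually_gt_right s)]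
        exact hC1
      · rw [hgt s h]; exact hCp s
    have hc : ∀ s ∈ S, c s = 0 := fun s hs =>
      (hpt s hs).eq_zero (natDegree_pointCoeff_le ..) (natDegree_pointCoeff_le ..)
        (natDegree_pointCoeff_le ..) (natDegree_pointCoeff_le ..) (hne s)
    have hpt' : ∀ s ∈ S, s ≠ ξ → PointEquation (glue ξ (am 0) (ap 0)) (glue ξ (am 1) (ap 1))
        (glue ξ (bm 0) (bp 0)) (glue ξ (bm 1) (bp 1)) f w s 0 0 0 0 0 := fun s hs hsξ => by
      have := hpt s hs
      simpa only [pointCoeff, if_neg hsξ, hc s hs] using this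
    have hreg : ∀ x ∉ S, ∀ k : Fin 4, jet (𝓝[>] x) f k = jet (𝓝[<] x) f k := fun x hx k => by
      rw [jet_of_contDiffAt (isSide_left x) (hf.contDiffAt x hx),
        jet_of_contDiffAt (isSide_right x) (hf.contDiffAt x hx)]
    obtain ⟨um, hum, hfm⟩ := exists_isBeamSolution_eqOn (contDiff_aSide ham) hCm hqm hf
      isOpen_Iio ordConnected_Iio nonempty_Iio (U := Iio ξ) (fun x hx k => by
        by_cases hxS : x ∈ S
        · exact jet_eq_of_pointEquation hf (contDiff_aSide ham) (hCm x)
            (by filter_upwards [Iio_mem_nhds hx] with y hy using glue_add_glue_of_lt am ap hy)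
            (hlt x hx) (hpt' x hxS (ne_of_lt hx)) k
        · exact hreg x hxS k) (fun x hx hxS => by
        have he : (fun y => (glue ξ (am 0) (ap 0) y + glue ξ (am 1) (ap 1) y) *
            deriv (deriv f) y) =ᶠ[𝓝 x] fun y => aSide am y * deriv (deriv f) y := by
          filter_upwards [Iio_mem_nhds hx] with y hy
          rw [glue_add_glue_of_lt am ap hy]
        rw [← he.deriv.deriv_eq, hode x hxS, glue_add_glue_of_lt bm bp hx, mul_assoc])
    obtain ⟨up, hup, hfp⟩ := exists_isBeamSolution_eqOn (contDiff_aSide hap) hCp hqp hf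
      isOpen_Ioi ordConnected_Ioi nonempty_Ioi (U := Ioi ξ) (fun x hx k => by
        by_cases hxS : x ∈ S
        · exact jet_eq_of_pointEquation hf (contDiff_aSide hap) (hCp x)
            (by filter_upwards [Ioi_mem_nhds hx] with y hy using glue_add_glue_of_gt am ap hy)
            (hgt x hx) (hpt' x hxS (ne_of_gt hx)) k
        · exact hreg x hxS k) (fun x hx hxS => by
        have he : (fun y => (glue ξ (am 0) (ap 0) y + glue ξ (am 1) (ap 1) y) *
            deriv (deriv f) y) =ᶠ[𝓝 x] fun y => aSide ap y * deriv (deriv f) y := by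
          filter_upwards [Ioi_mem_nhds hx] with y hy
          rw [glue_add_glue_of_gt am ap hy]
        rw [← he.deriv.deriv_eq, hode x hxS, glue_add_glue_of_gt bm bp hx, mul_assoc])
    have hξeq := hpt ξ hξ
    rw [hc ξ hξ, interface_equation_iff ham hap _ _ hf,
      jet_congr (isSide_left ξ) (g := um), jet_congr (isSide_right ξ) (g := up),
      jet_of_contDiffAt (isSide_left ξ) hum.contDiff.contDiffAt,
      jet_of_contDiffAt (isSide_right ξ) hup.contDiff.contDiffAt] at hξeq
    · refine ⟨um, up, hum, hup, hξeq, ?_⟩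
      rw [pw, Finset.sum_eq_zero fun s hs => by rw [hc s hs, map_zero], add_zero]
      refine regular_congr hf.locallyIntegrable
        (piecewiseSmooth_glue hξ hum.contDiff hup.contDiff).locallyIntegrable ?_
      filter_upwards [PiecewiseSmooth.ae_notMem S] with x hx
      rcases lt_or_gt_of_ne (fun h : x = ξ => hx (h ▸ hξ)) with h | h
      · rw [hfm x h hx, glue_of_lt _ _ h]
      · rw [hfp x h hx, glue_of_gt _ _ h]
    · filter_upwards [eventually_gt_right ξ, (isSide_right ξ).eventually_notMem S] with y hy hyS
      exact hfp y hy hyS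
    · filter_upwards [eventually_lt_left ξ, (isSide_left ξ).eventually_notMem S] with y hy hyS
      exact hfm y hy hyS
  · rintro ⟨um, up, hum, hup, hint, rfl⟩
    have hξ : ξ ∈ ({ξ} : Finset ℝ) := Finset.mem_singleton_self ξ
    have hf := piecewiseSmooth_glue hξ hum.contDiff hup.contDiff
    have hpw : regular (glue ξ um up) = pw {ξ} (glue ξ um up) fun _ => 0 := by simp [pw]
    refine ⟨regular_mem_spaceA hf, ?_⟩
    rw [hpw, ha, ha, hb, hb, coefficient_eq_pw hξ, coefficient_eq_pw hξ, coefficient_eq_pw hξ,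
      coefficient_eq_pw hξ, equation_iff (piecewiseSmooth_glue hξ (ham 0) (hap 0))
        (piecewiseSmooth_glue hξ (ham 1) (hap 1)) (piecewiseSmooth_glue hξ (hbm 0) (hbp 0))
        (piecewiseSmooth_glue hξ (hbm 1) (hbp 1)) hf]
    refine ⟨fun x hx => ?_, fun s hs => ?_⟩
    · rcases lt_or_gt_of_ne (fun h : x = ξ => hx (h ▸ hξ)) with h | h
      · have hg : glue ξ um up =ᶠ[𝓝 x] um := by
          filter_upwards [Iio_mem_nhds h] with y hy using glue_of_lt _ _ hy
        have he : (fun y => (glue ξ (am 0) (ap 0) y + glue ξ (am 1) (ap 1) y) *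
            deriv (deriv (glue ξ um up)) y) =ᶠ[𝓝 x] fun y => aSide am y * deriv (deriv um) y := by
          filter_upwards [Iio_mem_nhds h, hg.deriv.deriv] with y hy hy'
          rw [glue_add_glue_of_lt am ap hy, hy']
        rw [he.deriv.deriv_eq, hum.eq, glue_add_glue_of_lt bm bp h, glue_of_lt _ _ h, mul_assoc]
      · have hg : glue ξ um up =ᶠ[𝓝 x] up := by
          filter_upwards [Ioi_mem_nhds h] with y hy using glue_of_gt _ _ hy
        have he : (fun y => (glue ξ (am 0) (ap 0) y + glue ξ (am 1) (ap 1) y) *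
            deriv (deriv (glue ξ um up)) y) =ᶠ[𝓝 x] fun y => aSide ap y * deriv (deriv up) y := by
          filter_upwards [Ioi_mem_nhds h, hg.deriv.deriv] with y hy hy'
          rw [glue_add_glue_of_gt am ap hy, hy']
        rw [he.deriv.deriv_eq, hup.eq, glue_add_glue_of_gt bm bp h, glue_of_gt _ _ h, mul_assoc]
    · rw [Finset.mem_singleton] at hs
      subst hs
      rwa [interface_equation_iff ham hap _ _ hf,
        jet_glue_of_lt _ hum.contDiff (isSide_left s) (eventually_lt_left s),
        jet_glue_of_gt _ hup.contDiff (isSide_right s) (eventually_gt_right s)]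

/-- The boundary condition at `x₀` is a condition on the jet at `x₀` of any smooth function that
represents the distribution near `x₀`. -/
theorem satisfiesBC_iff {U : Set ℝ} (hU : IsOpen U) {f u : ℝ → ℂ} (hf : LocallyIntegrable f)
    (hu : ContDiff ℝ ∞ u) (h : EqOn f u U) {x₀ : ℝ} (hx₀ : x₀ ∈ U) (C : Fin 4 → ℂ) :
    SatisfiesBC x₀ C (regular f) ↔ ∀ k : Fin 4, iteratedDeriv k u x₀ = C k := by
  have hEq : ∀ V ⊆ U, EqOnOpen V (regular f) (regular u) := fun V hV t ht => by
    rw [regular_apply hf, regular_apply hu.continuous.locallyIntegrable]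
    refine integral_congr_ae (ae_of_all _ fun x => ?_)
    by_cases hx : x ∈ tsupport t
    · simp only [h (hV (ht hx))]
    · simp [image_eq_zero_of_notMem_tsupport hx]
  constructor
  · rintro ⟨α, β, hαβ, g, hg, hfg, hgC⟩ k
    have hV : IsOpen (U ∩ Ioo α β) := hU.inter isOpen_Ioo
    have hsu : IsSmoothFunOn (U ∩ Ioo α β) (regular f) u := ⟨hu.contDiffOn, fun t ht => by
      rw [hEq _ inter_subset_left t ht, regular_apply hu.continuous.locallyIntegrable]⟩
    have hsg : IsSmoothFunOn (U ∩ Ioo α β) (regular f) g := ⟨hg.contDiffOn, fun t ht => by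
      rw [hfg t (ht.trans inter_subset_right), regular_apply hg.continuous.locallyIntegrable]⟩
    have hug : u =ᶠ[𝓝 x₀] g := by
      filter_upwards [hV.mem_nhds ⟨hx₀, hαβ⟩] with y hy
      exact eqOn_of_isSmoothFunOn hV hV hsu hsg ⟨hy, hy⟩
    rw [hug.iteratedDeriv_eq, hgC]
  · intro hC
    obtain ⟨ε, hε, hball⟩ := Metric.isOpen_iff.1 hU x₀ hx₀
    rw [Real.ball_eq_Ioo] at hball
    exact ⟨x₀ - ε, x₀ + ε, ⟨by linarith, by linarith⟩, u, hu, hEq _ hball, hC⟩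

end Solutions

/-! ### The determinants -/

/-- Each of the alternatives (a), (b), (c) makes enough coefficients vanish for the determinant to
reduce to a product. -/
theorem OrderCondition.coeff_eq_zero {ξ : ℝ} {fm fp gm gp : ℝ → ℂ} (hfm : ContDiff ℝ ∞ fm)
    (hfp : ContDiff ℝ ∞ fp) (hgm : ContDiff ℝ ∞ gm) (hgp : ContDiff ℝ ∞ gp) {A : Fin 2 → ℂ}
    {B : Fin 4 → ℂ} (h : OrderCondition (coefficient ξ fm fp A) (coefficient ξ gm gp B)) :
    B 3 = 0 ∧ ((A 0 = 0 ∧ A 1 = 0) ∨ (A 1 = 0 ∧ B 2 = 0) ∨ (B 1 = 0 ∧ B 2 = 0)) := by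
  have hξ : ξ ∈ ({ξ} : Finset ℝ) := Finset.mem_singleton_self ξ
  have hA : ∀ n : ℕ, ord (coefficient ξ fm fp A) ≤ n → ∀ j : Fin 2, n ≤ (j : ℕ) → A j = 0 :=
    fun n hn j hj => by
      rw [coefficient_eq_pw hξ] at hn
      rw [← coeff_pointCoeff ξ A j]
      exact coeff_eq_zero_of_ord_le (piecewiseSmooth_glue hξ hfm hfp) hn hξ hj
  have hB : ∀ n : ℕ, ord (coefficient ξ gm gp B) ≤ n → ∀ j : Fin 4, n ≤ (j : ℕ) → B j = 0 :=
    fun n hn j hj => by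
      rw [coefficient_eq_pw hξ] at hn
      rw [← coeff_pointCoeff ξ B j]
      exact coeff_eq_zero_of_ord_le (piecewiseSmooth_glue hξ hgm hgp) hn hξ hj
  rcases h with ⟨h1, h2⟩ | ⟨h1, h2⟩ | ⟨h1, h2⟩
  · have h1' := hA 0 (by rw [h1]; rfl)
    exact ⟨hB 3 h2 3 le_rfl, Or.inl ⟨h1' 0 le_rfl, h1' 1 (Nat.zero_le _)⟩⟩
  · have h1' := hA 1 h1
    have h2' := hB 2 h2
    exact ⟨h2' 3 (by decide), Or.inr (Or.inl ⟨h1' 1 le_rfl, h2' 2 le_rfl⟩)⟩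
  · have h2' := hB 1 h2
    exact ⟨h2' 3 (by decide), Or.inr (Or.inr ⟨h2' 1 le_rfl, h2' 2 (by decide)⟩)⟩

theorem det_matB (ξ : ℝ) (w : ℂ) (am ap : Fin 2 → ℝ → ℂ) {A : Fin 2 → Fin 2 → ℂ}
    {B : Fin 2 → Fin 4 → ℂ} (h : B 0 3 = 0 ∧ ((A 0 0 = 0 ∧ A 0 1 = 0) ∨
      (A 0 1 = 0 ∧ B 0 2 = 0) ∨ (B 0 1 = 0 ∧ B 0 2 = 0))) :
    (matB ξ w am ap A B).det = aSide ap ξ ^ 2 * aMid am ap ξ ^ 2 := by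
  obtain ⟨h3, ⟨h1, h2⟩ | ⟨h1, h2⟩ | ⟨h1, h2⟩⟩ := h <;>
  · rw [matB, Matrix.det_succ_row_zero]
    simp [Fin.sum_univ_succ, Matrix.det_fin_three, Matrix.submatrix_apply, Fin.succAbove, h1, h2,
      h3]
    try ring

theorem det_matA (ξ : ℝ) (w : ℂ) (am ap : Fin 2 → ℝ → ℂ) {A : Fin 2 → Fin 2 → ℂ}
    {B : Fin 2 → Fin 4 → ℂ} (h : B 1 3 = 0 ∧ ((A 1 0 = 0 ∧ A 1 1 = 0) ∨
      (A 1 1 = 0 ∧ B 1 2 = 0) ∨ (B 1 1 = 0 ∧ B 1 2 = 0))) :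
    (matA ξ w am ap A B).det = aSide am ξ ^ 2 * aMid am ap ξ ^ 2 := by
  obtain ⟨h3, ⟨h1, h2⟩ | ⟨h1, h2⟩ | ⟨h1, h2⟩⟩ := h <;>
  · rw [matA, Matrix.det_succ_row_zero]
    simp [Fin.sum_univ_succ, Matrix.det_fin_three, Matrix.submatrix_apply, Fin.succAbove, h1, h2,
      h3]
    try ring

/-! ### The boundary value problem -/

section BoundaryValueProblem

variable {ξ : ℝ} {w : ℂ} {am ap bm bp : Fin 2 → ℝ → ℂ} {A : Fin 2 → Fin 2 → ℂ}
  {B : Fin 2 → Fin 4 → ℂ}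

/-- To the left of the interface the boundary value problem is uniquely solvable as soon as the
matrix acting on the right jet is invertible: the solution on the left is determined by `C`, the
right jet at the interface by the left one, and the solution on the right by that jet. -/
theorem existsUnique_of_lt (ham : ∀ i, ContDiff ℝ ∞ (am i)) (hap : ∀ i, ContDiff ℝ ∞ (ap i))
    (hbm : ∀ i, ContDiff ℝ ∞ (bm i)) (hbp : ∀ i, ContDiff ℝ ∞ (bp i)) {a b : Fin 2 → Distr}
    (ha : ∀ i, a i = coefficient ξ (am i) (ap i) (A i))
    (hb : ∀ i, b i = coefficient ξ (bm i) (bp i) (B i))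
    (hC1 : aMid am ap ξ ≠ 0) (hCm : ∀ x, aSide am x ≠ 0) (hCp : ∀ x, aSide ap x ≠ 0)
    (hdet : IsUnit (matB ξ w am ap A B).det) {x₀ : ℝ} (hx₀ : x₀ < ξ) (C : Fin 4 → ℂ) :
    ∃! φ : Distr, IsSolution a b w φ ∧ SatisfiesBC x₀ C φ := by
  have hqm : ContDiff ℝ ∞ fun x => w ^ 2 * aSide bm x := contDiff_const.mul (contDiff_aSide hbm)
  have hqp : ContDiff ℝ ∞ fun x => w ^ 2 * aSide bp x := contDiff_const.mul (contDiff_aSide hbp)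
  have hint : ∀ {um up : ℝ → ℂ}, ContDiff ℝ ∞ um → ContDiff ℝ ∞ up →
      LocallyIntegrable (glue ξ um up) := fun hm hp =>
    (piecewiseSmooth_glue (Finset.mem_singleton_self ξ) hm hp).locallyIntegrable
  obtain ⟨um, hum, humC⟩ := exists_isBeamSolution (contDiff_aSide ham) hCm hqm x₀ C
  obtain ⟨up, hup, hupC⟩ := exists_isBeamSolution (contDiff_aSide hap) hCp hqp ξ
    ((matB ξ w am ap A B)⁻¹.mulVec
      ((matA ξ w am ap A B).mulVec fun k => iteratedDeriv k um ξ))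
  have hmat : (matA ξ w am ap A B).mulVec (fun k => iteratedDeriv k um ξ) =
      (matB ξ w am ap A B).mulVec (fun k => iteratedDeriv k up ξ) := by
    rw [funext hupC, Matrix.mulVec_mulVec, Matrix.mul_nonsing_inv _ hdet, Matrix.one_mulVec]
  refine ⟨regular (glue ξ um up), ⟨(isSolution_iff ham hap hbm hbp ha hb hC1 hCm hCp).2
    ⟨um, up, hum, hup, hmat, rfl⟩, (satisfiesBC_iff isOpen_Iio (hint hum.contDiff hup.contDiff)
      hum.contDiff (fun x hx => glue_of_lt _ _ hx) hx₀ C).2 humC⟩, ?_⟩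
  rintro ψ ⟨hψ, hψC⟩
  obtain ⟨vm, vp, hvm, hvp, hmat', rfl⟩ :=
    (isSolution_iff ham hap hbm hbp ha hb hC1 hCm hCp).1 hψ
  rw [satisfiesBC_iff isOpen_Iio (hint hvm.contDiff hvp.contDiff) hvm.contDiff
    (fun x hx => glue_of_lt _ _ hx) hx₀] at hψC
  have hm : vm = um := hvm.unique (contDiff_aSide ham) hCm hqm hum fun k => by rw [hψC, humC]
  subst hm
  have hj := Matrix.mulVec_injective_of_isUnit ((Matrix.isUnit_iff_isUnit_det _).2 hdet)
    (hmat'.symm.trans hmat)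
  rw [hvp.unique (contDiff_aSide hap) hCp hqp hup (congrFun hj)]

/-- The mirror image of `existsUnique_of_lt`. -/
theorem existsUnique_of_gt (ham : ∀ i, ContDiff ℝ ∞ (am i)) (hap : ∀ i, ContDiff ℝ ∞ (ap i))
    (hbm : ∀ i, ContDiff ℝ ∞ (bm i)) (hbp : ∀ i, ContDiff ℝ ∞ (bp i)) {a b : Fin 2 → Distr}
    (ha : ∀ i, a i = coefficient ξ (am i) (ap i) (A i))
    (hb : ∀ i, b i = coefficient ξ (bm i) (bp i) (B i))
    (hC1 : aMid am ap ξ ≠ 0) (hCm : ∀ x, aSide am x ≠ 0) (hCp : ∀ x, aSide ap x ≠ 0)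
    (hdet : IsUnit (matA ξ w am ap A B).det) {x₀ : ℝ} (hx₀ : ξ < x₀) (C : Fin 4 → ℂ) :
    ∃! φ : Distr, IsSolution a b w φ ∧ SatisfiesBC x₀ C φ := by
  have hqm : ContDiff ℝ ∞ fun x => w ^ 2 * aSide bm x := contDiff_const.mul (contDiff_aSide hbm)
  have hqp : ContDiff ℝ ∞ fun x => w ^ 2 * aSide bp x := contDiff_const.mul (contDiff_aSide hbp)
  have hint : ∀ {um up : ℝ → ℂ}, ContDiff ℝ ∞ um → ContDiff ℝ ∞ up →
      LocallyIntegrable (glue ξ um up) := fun hm hp =>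
    (piecewiseSmooth_glue (Finset.mem_singleton_self ξ) hm hp).locallyIntegrable
  obtain ⟨up, hup, hupC⟩ := exists_isBeamSolution (contDiff_aSide hap) hCp hqp x₀ C
  obtain ⟨um, hum, humC⟩ := exists_isBeamSolution (contDiff_aSide ham) hCm hqm ξ
    ((matA ξ w am ap A B)⁻¹.mulVec
      ((matB ξ w am ap A B).mulVec fun k => iteratedDeriv k up ξ))
  have hmat : (matA ξ w am ap A B).mulVec (fun k => iteratedDeriv k um ξ) =
      (matB ξ w am ap A B).mulVec (fun k => iteratedDeriv k up ξ) := by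
    rw [funext humC, Matrix.mulVec_mulVec, Matrix.mul_nonsing_inv _ hdet, Matrix.one_mulVec]
  refine ⟨regular (glue ξ um up), ⟨(isSolution_iff ham hap hbm hbp ha hb hC1 hCm hCp).2
    ⟨um, up, hum, hup, hmat, rfl⟩, (satisfiesBC_iff isOpen_Ioi (hint hum.contDiff hup.contDiff)
      hup.contDiff (fun x hx => glue_of_gt _ _ hx) hx₀ C).2 hupC⟩, ?_⟩
  rintro ψ ⟨hψ, hψC⟩
  obtain ⟨vm, vp, hvm, hvp, hmat', rfl⟩ :=
    (isSolution_iff ham hap hbm hbp ha hb hC1 hCm hCp).1 hψ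
  rw [satisfiesBC_iff isOpen_Ioi (hint hvm.contDiff hvp.contDiff) hvp.contDiff
    (fun x hx => glue_of_gt _ _ hx) hx₀] at hψC
  have hp : vp = up := hvp.unique (contDiff_aSide hap) hCp hqp hup fun k => by rw [hψC, hupC]
  subst hp
  have hj := Matrix.mulVec_injective_of_isUnit ((Matrix.isUnit_iff_isUnit_det _).2 hdet)
    (hmat'.trans hmat.symm)
  rw [hvm.unique (contDiff_aSide ham) hCm hqm hum (congrFun hj)]

end BoundaryValueProblem

end

end EulerBernoulli

open EulerBernoulli in
theorem corollary3p5
    (ξ₀ : ℝ) (w : ℂ)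
    (am ap bm bp : Fin 2 → ℝ → ℂ)
    (ham : ∀ i, ContDiff ℝ ∞ (am i)) (hap : ∀ i, ContDiff ℝ ∞ (ap i))
    (hbm : ∀ i, ContDiff ℝ ∞ (bm i)) (hbp : ∀ i, ContDiff ℝ ∞ (bp i))
    (A : Fin 2 → Fin 2 → ℂ) (B : Fin 2 → Fin 4 → ℂ)
    (a b : Fin 2 → Distr)
    (ha : ∀ i, a i = coefficient ξ₀ (am i) (ap i) (A i))
    (hb : ∀ i, b i = coefficient ξ₀ (bm i) (bp i) (B i))
    (hC1 : aMid am ap ξ₀ ≠ 0)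
    (hC2 : ∀ x : ℝ, aSide am x ≠ 0 ∧ aSide ap x ≠ 0) :
    (OrderCondition (a 0) (b 0) →
      (∀ x₀ < ξ₀, ∀ C : Fin 4 → ℂ, ∃! φ : Distr, IsSolution a b w φ ∧ SatisfiesBC x₀ C φ) ∧
      (matB ξ₀ w am ap A B).det = aSide ap ξ₀ ^ 2 * aMid am ap ξ₀ ^ 2 ∧
      (matB ξ₀ w am ap A B).det ≠ 0) ∧
    (OrderCondition (a 1) (b 1) →
      (∀ x₀ > ξ₀, ∀ C : Fin 4 → ℂ, ∃! φ : Distr, IsSolution a b w φ ∧ SatisfiesBC x₀ C φ) ∧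
      (matA ξ₀ w am ap A B).det = aSide am ξ₀ ^ 2 * aMid am ap ξ₀ ^ 2 ∧
      (matA ξ₀ w am ap A B).det ≠ 0) := by
  have hCm := fun x => (hC2 x).1
  have hCp := fun x => (hC2 x).2
  refine ⟨fun h => ?_, fun h => ?_⟩
  · rw [ha, hb] at h
    have hdet := det_matB ξ₀ w am ap
      (h.coeff_eq_zero (ham 0) (hap 0) (hbm 0) (hbp 0))
    have hne : (matB ξ₀ w am ap A B).det ≠ 0 :=
      hdet ▸ mul_ne_zero (pow_ne_zero 2 (hCp ξ₀)) (pow_ne_zero 2 hC1)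
    exact ⟨fun x₀ hx₀ C => existsUnique_of_lt ham hap hbm hbp ha hb hC1 hCm hCp hne.isUnit hx₀ C,
      hdet, hne⟩
  · rw [ha, hb] at h
    have hdet := det_matA ξ₀ w am ap
      (h.coeff_eq_zero (ham 1) (hap 1) (hbm 1) (hbp 1))
    have hne : (matA ξ₀ w am ap A B).det ≠ 0 :=
      hdet ▸ mul_ne_zero (pow_ne_zero 2 (hCm ξ₀)) (pow_ne_zero 2 hC1)
    exact ⟨fun x₀ hx₀ C => existsUnique_of_gt ham hap hbm hbp ha hb hC1 hCm hCp hne.isUnit hx₀ C,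
      hdet, hne⟩
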